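/- Let $N\ge 1$, let $\Omega\subset\mathbb{R}^N$ be a bounded domain (nonempty, open, connected), let $1<p<\infty$, and let $s:\mathbb{R}^N\times\mathbb{R}^N\to(0,1)$ be continuous and symmetric with $0<\inf s\le\sup s<1$. Put $\Omega^c=\mathbb{R}^N\setminus\Omega$, $D_\Omega=(\mathbb{R}^N\times\mathbb{R}^N)\setminus(\Omega^c\times\Omega^c)$, $d\sigma=|x-y|^{-N-p\,s(x,y)}\,dx\,dy$ and $\widetilde u(x,y)=u(x)-u(y)$. Let $X_0^{s(\cdot,\cdot),p}(\Omega)$ be the space of $u\in L^p(\mathbb{R}^N)$ with $\int_\Omega|u|^p\,dx+\iint_{D_\Omega}|\widetilde u|^p\,d\sigma<\infty$ and $u=0$ a.e. in $\Omega^c$; functions on $\Omega$ are identified with their extensions by zero. Define $\mathcal{A}_p^{s(\cdot,\cdot)}:L^2(\Omega)\to[0,+\infty]$ by $$\mathcal{A}_p^{s(\cdot,\cdot)}(u)=\begin{cases}\dfrac1{2p}\displaystyle\iint_{D_\Omega}|\widetilde u|^p\,d\sigma & \text{if } u\in L^2(\Omega)\cap X_0^{s(\cdot,\cdot),p}(\Omega),\\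 +\infty&\text{otherwise,}\end{cases}$$ and define the (a priori multivalued) operator $A_p^{s(\cdot,\cdot)}\subset L^2(\Omega)\times L^2(\Omega)$ by: $v\in A_p^{s(\cdot,\cdot)}(u)$ if and only if $u\in L^2(\Omega)\cap X_0^{s(\cdot,\cdot),p}(\Omega)$, $v\in L^2(\Omega)$ and $$\int_\Omega v\,\varphi\,dx=\frac12\iint_{D_\Omega}|\widetilde u(x,y)|^{p-2}\,\widetilde u(x,y)\,\big(\varphi(x)-\varphi(y)\big)\,d\sigma\qquad\text{for all }\varphi\in L^2(\Omega)\cap X_0^{s(\cdot,\cdot),p}(\Omega).$$ Then $A_p^{s(\cdot,\cdot)}$ is $m$-completely accretive in $L^2(\Omega)$, that is, (i) for all $v\in A_p^{s(\cdot,\cdot)}(u)$, $v'\in A_p^{s(\cdot,\cdot)}(u')$, every $\lambda>0$ and every convex lower semicontinuous $j:\mathbb{R}\to[0,+\infty]$ with $j(0)=0$, $$\int_\Omega j(u-u')\,dx\le\int_\Omega j\big(u-u'+\lambda(v-v')\big)\,dx;$$ (ii) for every $\lambda>0$ the range of $I+\lambda A_p^{s(\cdot,\cdot)}$ is all of $L^2(\Omega)$.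 Moreover, the domain of $A_p^{s(\cdot,\cdot)}$ is dense in $L^2(\Omega)$, the functional $\mathcal{A}_p^{s(\cdot,\cdot)}$ is convex, and $A_p^{s(\cdot,\cdot)}=\partial\mathcal{A}_p^{s(\cdot,\cdot)}$, where $v\in\partial\Phi(u)$ means $\Phi(u)<\infty$ and $\Phi(w)\ge\Phi(u)+\int_\Omega v\,(w-u)\,dx$ for all $w\in L^2(\Omega)$. -/

import Mathlib

open MeasureTheory Set
open scoped ENNReal NNReal

noncomputable section

namespace VarFrac

/-- Euclidean space `ℝᴺ`. -/
abbrev E (N : ℕ) : Type := EuclideanSpace ℝ (Fin N)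

/-- The real Hilbert space `L²(Ω)`. -/
abbrev L2 {N : ℕ} (Ω : Set (E N)) : Type := Lp ℝ 2 (volume.restrict Ω)

/-- Standing assumptions on the order `s(·,·)`: continuous, symmetric, with values in `(0,1)` and
`0 < s⁻ = inf s ≤ sup s = s⁺ < 1`. -/
structure IsVariableOrder {N : ℕ} (s : E N → E N → ℝ) : Prop where
  continuous : Continuous fun z : E N × E N => s z.1 z.2
  symm : ∀ x y, s x y = s y x
  mem_Ioo : ∀ x y, s x y ∈ Ioo (0 : ℝ) 1
  inf_pos : 0 < (⨅ z : E N × E N, s z.1 z.2)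
  sup_lt_one : (⨆ z : E N × E N, s z.1 z.2) < 1

/-- `D_Ω = (ℝᴺ × ℝᴺ) \ (Ωᶜ × Ωᶜ)`. -/
def DΩ {N : ℕ} (Ω : Set (E N)) : Set (E N × E N) := (Ωᶜ ×ˢ Ωᶜ)ᶜ

/-- The measure `dσ = |x - y|^{-(N + p s(x,y))} dx dy` on `D_Ω`. -/
def sigma {N : ℕ} (p : ℝ) (s : E N → E N → ℝ) (Ω : Set (E N)) : Measure (E N × E N) :=
  ((volume : Measure (E N × E N)).withDensity fun z =>
    ENNReal.ofReal (1 / ‖z.1 - z.2‖ ^ ((N : ℝ) + p * s z.1 z.2))).restrict (DΩ Ω)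

/-- `ũ(x,y) = u(x) - u(y)`. -/
def tilde {N : ℕ} (u : E N → ℝ) (z : E N × E N) : ℝ := u z.1 - u z.2

/-- `∬_{D_Ω} |u(x) - u(y)|ᵖ dσ`, with values in `[0,∞]`. -/
def gagliardo {N : ℕ} (p : ℝ) (s : E N → E N → ℝ) (Ω : Set (E N)) (u : E N → ℝ) : ℝ≥0∞ :=
  ∫⁻ z, ENNReal.ofReal (|tilde u z| ^ p) ∂(sigma p s Ω)

/-- The space `X^{s(·,·),p}(Ω)`: the functions in `Lᵖ(ℝᴺ)` with
`∫_Ω |u|ᵖ dx + ∬_{D_Ω} |u(x) - u(y)|ᵖ dσ < ∞`. -/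
def X {N : ℕ} (p : ℝ) (s : E N → E N → ℝ) (Ω : Set (E N)) : Set (E N → ℝ) :=
  {u | MemLp u (ENNReal.ofReal p) volume ∧
    (∫⁻ x in Ω, ENNReal.ofReal (|u x| ^ p)) + gagliardo p s Ω u < ∞}

/-- The space `X₀^{s(·,·),p}(Ω)`: the functions of `X^{s(·,·),p}(Ω)` that vanish a.e. in `Ωᶜ`. -/
def X0 {N : ℕ} (p : ℝ) (s : E N → E N → ℝ) (Ω : Set (E N)) : Set (E N → ℝ) :=
  {u | u ∈ X p s Ω ∧ ∀ᵐ x ∂(volume.restrict Ωᶜ), u x = 0}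

/-- The extension of `u ∈ L²(Ω)` by zero outside `Ω`. -/
def zeroExt {N : ℕ} (Ω : Set (E N)) (u : L2 Ω) : E N → ℝ := Ω.indicator u

/-- `L²(Ω) ∩ X₀^{s(·,·),p}(Ω)`: a function on `Ω` is identified with its extension by zero. -/
def L2X0 {N : ℕ} (p : ℝ) (s : E N → E N → ℝ) (Ω : Set (E N)) : Set (L2 Ω) :=
  {u | zeroExt Ω u ∈ X0 p s Ω}

open Classical in
/-- The functional `𝒜(u) = (1/2p) ∬_{D_Ω} |ũ|ᵖ dσ` on `L²(Ω) ∩ X₀`, and `+∞` elsewhere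
in `L²(Ω)`. -/
def functionalA {N : ℕ} (p : ℝ) (s : E N → E N → ℝ) (Ω : Set (E N)) (u : L2 Ω) : ℝ≥0∞ :=
  if u ∈ L2X0 p s Ω then ENNReal.ofReal (1 / (2 * p)) * gagliardo p s Ω (zeroExt Ω u) else ∞

/-- The (graph of the) operator `A`: `v ∈ A(u)` iff `u ∈ L²(Ω) ∩ X₀`, `v ∈ L²(Ω)` and
`∫_Ω v φ dx = (1/2) ∬_{D_Ω} |ũ|^{p-2} ũ (φ(x) - φ(y)) dσ` for all `φ ∈ L²(Ω) ∩ X₀`. -/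
def operatorA {N : ℕ} (p : ℝ) (s : E N → E N → ℝ) (Ω : Set (E N)) : Set (L2 Ω × L2 Ω) :=
  {w | w.1 ∈ L2X0 p s Ω ∧ ∀ φ ∈ L2X0 p s Ω,
    ∫ x in Ω, w.2 x * φ x =
      (1 / 2) * ∫ z, |tilde (zeroExt Ω w.1) z| ^ (p - 2) * tilde (zeroExt Ω w.1) z *
        tilde (zeroExt Ω φ) z ∂(sigma p s Ω)}

/-- The domain of a multivalued operator, given by its graph. -/
def opDomain {H : Type*} (A : Set (H × H)) : Set H := {u | ∃ v, (u, v) ∈ A}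

/-- The graph of the subdifferential of `Φ : H → [0,∞]`: `v ∈ ∂Φ(u)` iff `Φ(u) < ∞` and
`Φ(w) ≥ Φ(u) + ⟨v, w - u⟩` for all `w`. -/
def subdifferential {H : Type*} [NormedAddCommGroup H] [InnerProductSpace ℝ H] (Φ : H → ℝ≥0∞) :
    Set (H × H) :=
  {q | Φ q.1 ≠ ∞ ∧
    ∀ w : H, ((Φ q.1 : ℝ≥0∞) : EReal) + ((inner ℝ q.2 (w - q.1) : ℝ) : EReal) ≤ (Φ w : EReal)}

/-- The class `J₀` of convex lower semicontinuous `j : ℝ → [0,∞]` with `j(0) = 0`. -/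
def J0 : Set (ℝ → ℝ≥0∞) := {j | ConvexOn ℝ≥0 univ j ∧ LowerSemicontinuous j ∧ j 0 = 0}

/-- The relation `f ≪ g` of Bénilan and Crandall: `∫_Ω j(f) ≤ ∫_Ω j(g)` for all `j ∈ J₀`. -/
def Dominated {N : ℕ} {Ω : Set (E N)} (f g : L2 Ω) : Prop :=
  ∀ j ∈ J0, ∫⁻ x in Ω, j (f x) ≤ ∫⁻ x in Ω, j (g x)

/-- Complete accretivity in `L²(Ω)`: `u - u' ≪ u - u' + r (v - v')` for all `r > 0` and all
`(u, v), (u', v')` in the graph. -/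
def IsCompletelyAccretive {N : ℕ} {Ω : Set (E N)} (A : Set (L2 Ω × L2 Ω)) : Prop :=
  ∀ w ∈ A, ∀ w' ∈ A, ∀ r : ℝ, 0 < r →
    Dominated (w.1 - w'.1) (w.1 - w'.1 + r • (w.2 - w'.2))

/-- `m`-complete accretivity in `L²(Ω)`: complete accretivity together with
`R(I + rA) = L²(Ω)` for all `r > 0`. -/
def IsMCompletelyAccretive {N : ℕ} {Ω : Set (E N)} (A : Set (L2 Ω × L2 Ω)) : Prop :=
  IsCompletelyAccretive A ∧ ∀ r : ℝ, 0 < r → ∀ h : L2 Ω, ∃ w ∈ A, w.1 + r • w.2 = h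

end VarFrac

end

/-! The operator is the first variation of a convex functional, so the claims split into Hilbert
space convexity and one pointwise monotonicity argument.

The functional is convex because `|·|ᵖ` is, and lower semicontinuous by Fatou. For every such proper
`Φ`, minimising `Φ u + ‖u - h‖² / (2r)` solves `u + r ∂Φ(u) ∋ h` (`exists_resolvent`), and letting
`r → 0` shows that the domain of `∂Φ` is dense in `{Φ < ∞}`. The range condition and the density of
the domain then follow from `operatorA_eq_subdifferential` and `dense_L2X0`. Boundedness of `Ω`
gives a Poincaré inequality (`exists_poincare`), so a finite Gagliardo energy alone characterises
`L²(Ω) ∩ X₀`.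

For complete accretivity, let `q` be nondecreasing and Lipschitz with `q 0 = 0`. Then `q(u - u')` is
an admissible test function, and since `a ↦ |a|^(p-2) a` is also nondecreasing, `∫ q(u - u') (v -
v') ≥ 0` (`integral_comp_mul_nonneg`). If `q` is the derivative of a convex `k`, the subgradient
inequality integrates to the domination inequality for `k`. A general `j ∈ J0` may have corners or
infinite values; its Moreau envelopes (`exists_moreau`) lie below `j` and recover it in the limit
(`le_liminf_of_moreau`), and Fatou concludes. -/

noncomputable section

namespace VarFrac

open Filter Topology

/-! ### The quadratically perturbed functional. -/

section Proximal

variable {H : Type*} [NormedAddCommGroup H] {Φ : H → ℝ≥0∞}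

/-- The functional minimised by the resolvent. -/
def proximal (Φ : H → ℝ≥0∞) (r : ℝ) (h u : H) : ℝ≥0∞ :=
  Φ u + ENNReal.ofReal (‖u - h‖ ^ 2 / (2 * r))

theorem proximal_toReal {r : ℝ} (hr : 0 < r) {h u : H} (hu : Φ u ≠ ∞) :
    (proximal Φ r h u).toReal = (Φ u).toReal + ‖u - h‖ ^ 2 / (2 * r) := by
  rw [proximal, ENNReal.toReal_add hu ENNReal.ofReal_ne_top, ENNReal.toReal_ofReal (by positivity)]

theorem proximal_ne_top_iff {r : ℝ} {h u : H} : proximal Φ r h u ≠ ∞ ↔ Φ u ≠ ∞ := by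
  simp [proximal]

end Proximal

/-! ### Subdifferentials and resolvents in a Hilbert space. -/

section Subdifferential

variable {H : Type*} [NormedAddCommGroup H] [InnerProductSpace ℝ H] {Φ : H → ℝ≥0∞}

theorem coe_add_le_coe_iff {a b : ℝ≥0∞} (ha : a ≠ ∞) (hb : b ≠ ∞) (c : ℝ) :
    (a : EReal) + (c : EReal) ≤ (b : EReal) ↔ a.toReal + c ≤ b.toReal := by
  lift a to ℝ≥0 using ha
  lift b to ℝ≥0 using hb
  simp only [ENNReal.coe_toReal]
  change ((a : ℝ) : EReal) + (c : EReal) ≤ ((b : ℝ) : EReal) ↔ _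
  rw [← EReal.coe_add, EReal.coe_le_coe_iff]

theorem mem_subdifferential_iff {u v : H} :
    (u, v) ∈ subdifferential Φ ↔
      Φ u ≠ ∞ ∧ ∀ w, Φ w ≠ ∞ → (Φ u).toReal + inner ℝ v (w - u) ≤ (Φ w).toReal := by
  simp only [subdifferential, mem_ofPred_eq]
  refine and_congr_right fun hu => forall_congr' fun w => ?_
  by_cases hw : Φ w = ∞
  · simp [hw]
  · simp [hw, coe_add_le_coe_iff hu hw]

theorem convex_toReal_le (hconv : ConvexOn ℝ≥0 univ Φ) {x y : H} (hx : Φ x ≠ ∞) (hy : Φ y ≠ ∞)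
    {t : ℝ} (ht0 : 0 ≤ t) (ht1 : t ≤ 1) :
    Φ (x + t • (y - x)) ≠ ∞ ∧
      (Φ (x + t • (y - x))).toReal ≤ (1 - t) * (Φ x).toReal + t * (Φ y).toReal := by
  have hc := hconv.2
  have key := hc (mem_univ x) (mem_univ y) (a := (1 - t).toNNReal) (b := t.toNNReal)
    zero_le zero_le (by
      rw [← Real.toNNReal_add (by linarith) ht0]; simp)
  have e : (1 - t).toNNReal • x + t.toNNReal • y = x + t • (y - x) := by
    simp only [NNReal.smul_def, Real.coe_toNNReal _ ht0,
      Real.coe_toNNReal (1 - t) (by linarith)]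
    module
  rw [e] at key
  have hx' : (1 - t).toNNReal • Φ x ≠ ∞ := by
    rw [ENNReal.smul_def, smul_eq_mul]; exact ENNReal.mul_ne_top ENNReal.coe_ne_top hx
  have hy' : t.toNNReal • Φ y ≠ ∞ := by
    rw [ENNReal.smul_def, smul_eq_mul]; exact ENNReal.mul_ne_top ENNReal.coe_ne_top hy
  have hfin := ENNReal.add_ne_top.2 ⟨hx', hy'⟩
  refine ⟨ne_top_of_le_ne_top hfin key, ?_⟩
  have := ENNReal.toReal_mono hfin key
  rw [ENNReal.toReal_add hx' hy'] at this
  simpa [ENNReal.smul_def, Real.coe_toNNReal _ ht0,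
      Real.coe_toNNReal (1 - t) (by linarith : (0 : ℝ) ≤ 1 - t)] using this

theorem nonneg_of_forall_small {a b : ℝ} (h : ∀ t : ℝ, 0 < t → t ≤ 1 → 0 ≤ a + t * b) : 0 ≤ a := by
  have : Tendsto (fun t : ℝ => a + t * b) (𝓝[>] 0) (𝓝 (a + 0 * b)) :=
    (Continuous.tendsto (by fun_prop) 0).mono_left nhdsWithin_le_nhds
  rw [zero_mul, add_zero] at this
  refine ge_of_tendsto this ?_
  filter_upwards [Ioc_mem_nhdsGT (zero_lt_one (α := ℝ))] with t ht using h t ht.1 ht.2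

/-- Comparing `u` with `u + t(w - u)` and dividing by `t` leaves the subgradient inequality up to a
term of order `t`, which vanishes as `t → 0`. -/
theorem mem_subdifferential_of_isMin (hconv : ConvexOn ℝ≥0 univ Φ) {r : ℝ} (hr : 0 < r)
    {h u : H} (hu : Φ u ≠ ∞) (hmin : ∀ w, proximal Φ r h u ≤ proximal Φ r h w) :
    (u, r⁻¹ • (h - u)) ∈ subdifferential Φ := by
  rw [mem_subdifferential_iff]
  refine ⟨hu, fun w hw => ?_⟩
  have key : 0 ≤ ((Φ w).toReal - (Φ u).toReal - inner ℝ (r⁻¹ • (h - u)) (w - u)) := by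
    refine nonneg_of_forall_small (b := ‖w - u‖ ^ 2 / (2 * r)) fun t ht0 ht1 => ?_
    obtain ⟨hfin, hle⟩ := convex_toReal_le hconv hu hw ht0.le ht1
    have h1 := ENNReal.toReal_mono (proximal_ne_top_iff.2 hfin) (hmin (u + t • (w - u)))
    rw [proximal_toReal hr hu, proximal_toReal hr hfin] at h1
    have h2 : ‖u + t • (w - u) - h‖ ^ 2 =
        ‖u - h‖ ^ 2 - 2 * t * inner ℝ (h - u) (w - u) + t ^ 2 * ‖w - u‖ ^ 2 := by
      have : u + t • (w - u) - h = t • (w - u) - (h - u) := by abel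
      rw [this, norm_sub_sq_real, norm_smul, mul_pow, inner_smul_left, Real.norm_eq_abs, sq_abs,
        norm_sub_rev u h, real_inner_comm]
      simp; ring
    rw [inner_smul_left]
    rw [h2] at h1
    simp only [conj_trivial]
    have h3 : 0 ≤ t * ((Φ w).toReal - (Φ u).toReal - r⁻¹ * inner ℝ (h - u) (w - u)
        + t * (‖w - u‖ ^ 2 / (2 * r))) := by
      have e : (‖u - h‖ ^ 2 - 2 * t * inner ℝ (h - u) (w - u) + t ^ 2 * ‖w - u‖ ^ 2) / (2 * r) =
        ‖u - h‖ ^ 2 / (2 * r) - t * (r⁻¹ * inner ℝ (h - u) (w - u))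
          + t * (t * (‖w - u‖ ^ 2 / (2 * r))) := by field_simp
      rw [e] at h1
      linarith
    exact nonneg_of_mul_nonneg_right h3 ht0
  linarith

/-- No compactness is needed: the quadratic term is uniformly convex, so a minimising sequence is
Cauchy, and lower semicontinuity identifies its limit as a minimiser. -/
theorem exists_proximal_isMin [CompleteSpace H] (hconv : ConvexOn ℝ≥0 univ Φ)
    (hlsc : LowerSemicontinuous Φ) {x₀ : H} (hx₀ : Φ x₀ ≠ ∞) {r : ℝ} (hr : 0 < r) (h : H) :
    ∃ u, Φ u ≠ ∞ ∧ ∀ w, proximal Φ r h u ≤ proximal Φ r h w := by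
  set F := proximal Φ r h with hF
  set m := ⨅ w, F w with hm
  have hmtop : m ≠ ∞ := ne_top_of_le_ne_top (proximal_ne_top_iff.2 hx₀) (iInf_le F x₀)
  have hseq : ∀ n : ℕ, ∃ w, F w < m + ENNReal.ofReal (1 / (n + 1 : ℝ)) := fun n => by
    refine iInf_lt_iff.1 (ENNReal.lt_add_right hmtop ?_)
    rw [Ne, ENNReal.ofReal_eq_zero, not_le]
    positivity
  choose w hw using hseq
  have hwtop : ∀ n, Φ (w n) ≠ ∞ := fun n => proximal_ne_top_iff.1 (hw n).ne_top
  have hwR : ∀ n : ℕ, (F (w n)).toReal ≤ m.toReal + 1 / (n + 1 : ℝ) := fun n => by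
    have := ENNReal.toReal_mono (by simp [hmtop]) (hw n).le
    rwa [ENNReal.toReal_add hmtop ENNReal.ofReal_ne_top, ENNReal.toReal_ofReal (by positivity)]
      at this
  -- The midpoint of `w n` and `w k` is a competitor; by the parallelogram law it gains `‖w n - w
  -- k‖² / (8r)` over the average of the two values.
  have hpar : ∀ n k : ℕ, ‖w n - w k‖ ^ 2 ≤ 4 * r * (1 / (n + 1 : ℝ) + 1 / (k + 1 : ℝ)) := by
    intro n k
    obtain ⟨hfin, hle⟩ := convex_toReal_le hconv (hwtop n) (hwtop k) (t := 1 / 2)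
      (by norm_num) (by norm_num)
    have h1 : m.toReal ≤ (F (w n + (1 / 2 : ℝ) • (w k - w n))).toReal :=
      ENNReal.toReal_mono (proximal_ne_top_iff.2 hfin) (iInf_le F _)
    rw [hF, proximal_toReal hr hfin] at h1
    have h2 := hwR n
    have h3 := hwR k
    rw [hF, proximal_toReal hr (hwtop _)] at h2 h3
    have h4 : ‖w n + (1 / 2 : ℝ) • (w k - w n) - h‖ ^ 2 =
        ‖w n - h‖ ^ 2 / 2 + ‖w k - h‖ ^ 2 / 2 - ‖w n - w k‖ ^ 2 / 4 := by
      have e1 : w n + (1 / 2 : ℝ) • (w k - w n) - h =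
        (1 / 2 : ℝ) • ((w n - h) + (w k - h)) := by module
      have e2 : w n - w k = (w n - h) - (w k - h) := by abel
      have := parallelogram_law_with_norm ℝ (w n - h) (w k - h)
      rw [e1, e2, norm_smul, mul_pow]
      norm_num
      norm_num at this
      linarith
    rw [h4] at h1
    have e : (‖w n - h‖ ^ 2 / 2 + ‖w k - h‖ ^ 2 / 2 - ‖w n - w k‖ ^ 2 / 4) / (2 * r) =
      ‖w n - h‖ ^ 2 / (2 * r) / 2 + ‖w k - h‖ ^ 2 / (2 * r) / 2 - ‖w n - w k‖ ^ 2 / (4 * r) / 2 := by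
      field_simp
    rw [e] at h1
    have h5 : ‖w n - w k‖ ^ 2 / (4 * r) ≤ 1 / (n + 1 : ℝ) + 1 / (k + 1 : ℝ) := by linarith
    rw [div_le_iff₀ (by positivity)] at h5
    linarith
  have hcauchy : CauchySeq w := by
    refine cauchySeq_of_le_tendsto_0 (fun n : ℕ => Real.sqrt (8 * r * (1 / (n + 1 : ℝ)))) ?_ ?_
    · intro n k N hn hk
      rw [dist_eq_norm]
      refine Real.le_sqrt_of_sq_le ((hpar n k).trans ?_)
      have a1 := Nat.one_div_le_one_div (α := ℝ) hn
      have a2 := Nat.one_div_le_one_div (α := ℝ) hk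
      nlinarith
    · have := (tendsto_one_div_add_atTop_nhds_zero_nat (𝕜 := ℝ)).const_mul (8 * r)
      have := (Real.continuous_sqrt.tendsto _).comp this
      simpa [Function.comp_def] using this
  obtain ⟨u, hu⟩ := cauchySeq_tendsto_of_complete hcauchy
  have hFlsc : LowerSemicontinuous F := hlsc.add
    (Continuous.lowerSemicontinuous (ENNReal.continuous_ofReal.comp (by fun_prop)))
  have hFu : F u ≤ m := by
    refine ENNReal.le_of_forall_pos_le_add fun ε hε _ => ?_
    have hcl : IsClosed (F ⁻¹' Iic (m + ε)) :=
      lowerSemicontinuous_iff_isClosed_preimage.1 hFlsc _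
    refine hcl.mem_of_tendsto hu ?_
    have := (tendsto_one_div_add_atTop_nhds_zero_nat (𝕜 := ℝ)).eventually_lt_const
      (show (0 : ℝ) < ε from hε)
    filter_upwards [this] with n hn
    refine (hw n).le.trans (add_le_add le_rfl ?_)
    exact (ENNReal.ofReal_le_ofReal hn.le).trans (by simp)
  refine ⟨u, proximal_ne_top_iff.1 (ne_top_of_le_ne_top hmtop hFu), fun w => hFu.trans (iInf_le F w)⟩

/-- Solvability of the resolvent equation for the subdifferential of a proper convex lower
semicontinuous functional. -/
theorem exists_resolvent [CompleteSpace H] (hconv : ConvexOn ℝ≥0 univ Φ)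
    (hlsc : LowerSemicontinuous Φ) {x₀ : H} (hx₀ : Φ x₀ ≠ ∞) {r : ℝ} (hr : 0 < r) (h : H) :
    ∃ u, (u, r⁻¹ • (h - u)) ∈ subdifferential Φ := by
  obtain ⟨u, hu, hmin⟩ := exists_proximal_isMin hconv hlsc hx₀ hr h
  exact ⟨u, mem_subdifferential_of_isMin hconv hr hu hmin⟩

/-- Let `u n` be the resolvent of `x` with parameter `1/(n+1)`. Testing its subgradient inequality
at `x` gives `‖x - u n‖² ≤ Φ x / (n+1)`, so `u n → x`. -/
theorem dense_opDomain_subdifferential [CompleteSpace H] (hconv : ConvexOn ℝ≥0 univ Φ)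
    (hlsc : LowerSemicontinuous Φ) (hdense : Dense {x | Φ x ≠ ∞}) :
    Dense (opDomain (subdifferential Φ)) := by
  have hsub : {x | Φ x ≠ ∞} ⊆ closure (opDomain (subdifferential Φ)) := by
    intro x hx
    have hr : ∀ n : ℕ, (0 : ℝ) < 1 / (n + 1 : ℝ) := fun n => by positivity
    choose u hu using fun n => exists_resolvent hconv hlsc hx (hr n) x
    refine mem_closure_of_tendsto (f := u) (b := atTop) ?_ (Eventually.of_forall fun n => ⟨_, hu n⟩)
    rw [tendsto_iff_norm_sub_tendsto_zero]
    have hlim : Tendsto (fun n : ℕ => Real.sqrt ((1 / (n + 1 : ℝ)) * (Φ x).toReal)) atTop (𝓝 0) := by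
      have := (tendsto_one_div_add_atTop_nhds_zero_nat (𝕜 := ℝ)).mul_const ((Φ x).toReal)
      have := (Real.continuous_sqrt.tendsto _).comp this
      simpa [Function.comp_def] using this
    refine squeeze_zero (fun _ => norm_nonneg _) (fun n => ?_) hlim
    refine Real.le_sqrt_of_sq_le ?_
    have h1 := (mem_subdifferential_iff.1 (hu n)).2 x hx
    rw [inner_smul_left, real_inner_self_eq_norm_sq, conj_trivial] at h1
    have h2 : (1 / (n + 1 : ℝ))⁻¹ * ‖x - u n‖ ^ 2 ≤ (Φ x).toReal :=
      le_trans (le_add_of_nonneg_left ENNReal.toReal_nonneg) h1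
    rw [norm_sub_rev]
    rwa [inv_mul_le_iff₀ (hr n)] at h2
  exact (hdense.mono hsub).of_closure

end Subdifferential

/-! ### Moreau envelopes and Yosida approximation on the line. -/

section Yosida

/-- Regularisation of a convex lower semicontinuous `j` with `j 0 = 0`: `k` is the Moreau envelope,
`q` its derivative and `P` the proximal map. -/
theorem exists_moreau {j : ℝ → ℝ≥0∞} (hj : j ∈ J0) {l : ℝ} (hl : 0 < l) :
    ∃ (P q k : ℝ → ℝ), (∀ x, x = P x + l * q x) ∧ Continuous P ∧ (∃ C, LipschitzWith C q) ∧
      Monotone q ∧ q 0 = 0 ∧ Measurable k ∧ (∀ x, 0 ≤ k x) ∧ (∀ x, k x ≤ 2 / l * x ^ 2) ∧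
      (∀ x y, k x + q x * (y - x) ≤ k y) ∧ (∀ x, ENNReal.ofReal (k x) ≤ j x) ∧
      (∀ x, ENNReal.ofReal (k x) = j (P x) + ENNReal.ofReal (l / 2 * q x ^ 2)) := by
  obtain ⟨hconv, hlsc, hj0⟩ := hj
  have hjz : j 0 ≠ ∞ := by simp [hj0]
  choose P hP using fun x => exists_resolvent hconv hlsc hjz hl x
  set q : ℝ → ℝ := fun x => l⁻¹ * (x - P x) with hq
  have hxe : ∀ x, x = P x + l * q x := fun x => by simp only [hq]; field_simp; ring
  have hsub : ∀ x, j (P x) ≠ ∞ ∧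
      ∀ w, j w ≠ ∞ → (j (P x)).toReal + q x * (w - P x) ≤ (j w).toReal := by
    intro x
    obtain ⟨h1, h2⟩ := mem_subdifferential_iff.1 (hP x)
    refine ⟨h1, fun w hw => ?_⟩
    have := h2 w hw
    simp only [RCLike.inner_apply, smul_eq_mul, conj_trivial] at this
    simp only [hq]
    linarith
  have hmono : ∀ x y, 0 ≤ (q x - q y) * (P x - P y) := fun x y => by
    have h1 := (hsub x).2 (P y) (hsub y).1
    have h2 := (hsub y).2 (P x) (hsub x).1
    linarith
  have hqmono : Monotone q := by
    intro x y hxy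
    by_contra! hlt
    have h1 := hmono x y
    have h2 := hxe x
    have h3 := hxe y
    have h4 : l * q y < l * q x := mul_lt_mul_of_pos_left hlt hl
    have h5 : P x - P y < 0 := by linarith
    nlinarith
  have hPmono : Monotone P := by
    intro x y hxy
    by_contra! hlt
    have h1 := hmono x y
    have h2 := hxe x
    have h3 := hxe y
    have h5 : l * q x < l * q y := by linarith
    have h4 : q x < q y := lt_of_mul_lt_mul_left h5 hl.le
    nlinarith
  -- In `x = P x + l * q x` both summands are nondecreasing, so neither can grow faster than `x`.
  have hqLip : LipschitzWith (Real.toNNReal l⁻¹) q := by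
    refine LipschitzWith.of_le_add_mul _ fun x y => ?_
    rw [Real.coe_toNNReal _ (by positivity), Real.dist_eq]
    rcases le_total x y with h | h
    · have := hqmono h
      have : 0 ≤ l⁻¹ * |x - y| := by positivity
      linarith
    · have h1 := hPmono h
      rw [abs_of_nonneg (by linarith)]
      simp only [hq]
      have : 0 ≤ l⁻¹ * (P x - P y) := mul_nonneg (by positivity) (by linarith)
      linarith
  have hPeq : P = fun x => x - l * q x := by funext x; linarith [hxe x]
  have hPcont : Continuous P := by rw [hPeq]; exact continuous_id.sub (hqLip.continuous.const_mul l)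
  have hzero : ∀ x, (j (P x)).toReal ≤ q x * P x := fun x => by
    have := (hsub x).2 0 hjz
    simp only [hj0, ENNReal.toReal_zero] at this
    linarith
  have hP0 : P 0 = 0 := by
    have h1 := hzero 0
    have h2 := hxe 0
    have h3 : 0 ≤ q 0 * P 0 := ENNReal.toReal_nonneg.trans h1
    have h4 : P 0 * P 0 = - l * (q 0 * P 0) := by
      have : P 0 = - (l * q 0) := by linarith
      nth_rewrite 1 [this]; ring
    have : P 0 * P 0 ≤ 0 := by rw [h4]; nlinarith
    nlinarith [mul_self_eq_zero.1 (le_antisymm this (mul_self_nonneg _))]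
  have hq0 : q 0 = 0 := by simp [hq, hP0]
  set k : ℝ → ℝ := fun x => (j (P x)).toReal + l / 2 * q x ^ 2 with hk
  have hkj : ∀ x, ENNReal.ofReal (k x) = j (P x) + ENNReal.ofReal (l / 2 * q x ^ 2) := fun x => by
    rw [hk, ENNReal.ofReal_add ENNReal.toReal_nonneg (by positivity),
      ENNReal.ofReal_toReal (hsub x).1]
  refine ⟨P, q, k, hxe, hPcont, ⟨_, hqLip⟩, hqmono, hq0, ?_, fun x => by positivity, ?_, ?_, ?_,
    hkj⟩
  · exact ((hlsc.measurable.comp hPcont.measurable).ennreal_toReal).add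
      ((hqLip.continuous.pow 2).const_mul _).measurable
  -- The constant 2 is not sharp; any quadratic bound suffices, as it only serves to make `k` of an
  -- `L²` function integrable.
  · intro x
    have h1 := hzero x
    have h2 : q x ^ 2 * l ^ 2 ≤ x ^ 2 := by
      have h3 : 0 ≤ q x * P x := ENNReal.toReal_nonneg.trans h1
      have h4 : x ^ 2 = P x ^ 2 + 2 * l * (q x * P x) + q x ^ 2 * l ^ 2 := by
        conv_lhs => rw [hxe x]
        ring
      nlinarith [sq_nonneg (P x), mul_nonneg hl.le h3]
    have h5 : k x ≤ q x * x := by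
      have : q x * x = q x * P x + l * q x ^ 2 := by linear_combination q x * hxe x
      simp only [hk]
      nlinarith [mul_nonneg hl.le (sq_nonneg (q x))]
    refine h5.trans ?_
    have h6 : l * (q x * x) ≤ 2 * x ^ 2 := by nlinarith [sq_nonneg (l * q x - x)]
    rw [div_mul_eq_mul_div, le_div_iff₀ hl]
    linarith
  -- The subgradient inequality for `j` at `P x`, tested at `P y`, leaves the surplus `l/2 * (q y -
  -- q x)²`.
  · intro x y
    have h1 := (hsub x).2 (P y) (hsub y).1
    have h2 : q x * (y - x) = q x * (P y - P x) + l * (q x * (q y - q x)) := by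
      rw [show y - x = (P y - P x) + l * (q y - q x) by linarith [hxe x, hxe y]]; ring
    simp only [hk]
    rw [h2]
    nlinarith [mul_nonneg hl.le (sq_nonneg (q y - q x))]
  · intro x
    by_cases hx : j x = ∞
    · simp [hx]
    · refine ENNReal.ofReal_le_of_le_toReal ?_
      have h1 := (hsub x).2 x hx
      have h2 : q x * (x - P x) = l * q x ^ 2 := by
        rw [show x - P x = l * q x by linarith [hxe x]]; ring
      simp only [hk]
      nlinarith [mul_nonneg hl.le (sq_nonneg (q x))]

/-- A regularisation of `j` that converges pointwise from below, in the sense of Fatou's lemma. -/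
theorem le_liminf_of_moreau {j : ℝ → ℝ≥0∞} (hlsc : LowerSemicontinuous j) {l : ℕ → ℝ}
    (hl : ∀ n, 0 < l n) (hl0 : Tendsto l atTop (𝓝 0)) {P q : ℕ → ℝ} {x : ℝ}
    (hx : ∀ n, x = P n + l n * q n) :
    j x ≤ liminf (fun n => j (P n) + ENNReal.ofReal (l n / 2 * q n ^ 2)) atTop := by
  refine le_of_forall_lt fun c hc => ?_
  obtain ⟨c', hcc', hc'⟩ := exists_between hc
  refine hcc'.trans_le (le_liminf_of_le (by isBoundedDefault) ?_)
  obtain ⟨δ, hδ, hball⟩ := Metric.eventually_nhds_iff.1 (hlsc x c' hc')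
  have hcr : c' ≠ ∞ := hc'.ne_top
  have hlim : Tendsto (fun n => 2 * c'.toReal * l n) atTop (𝓝 0) := by
    simpa using hl0.const_mul (2 * c'.toReal)
  filter_upwards [hlim.eventually_lt_const (show (0 : ℝ) < δ ^ 2 by positivity)] with n hn
  -- Either `P n` is close to `x` and lower semicontinuity applies, or `|l n * q n| ≥ δ` and the
  -- quadratic term is at least `δ² / (2 * l n)`, hence above `c'`.
  by_cases hd : dist (P n) x < δ
  · exact (hball hd).le.trans le_self_add
  · refine le_trans ?_ le_add_self
    rw [← ENNReal.ofReal_toReal hcr]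
    refine ENNReal.ofReal_le_ofReal ?_
    have h1 : δ ≤ |l n * q n| := by
      rw [not_lt, Real.dist_eq, abs_sub_comm] at hd
      rwa [show l n * q n = x - P n by linarith [hx n]]
    have h2 : δ ^ 2 ≤ (l n * q n) ^ 2 := by
      rw [← sq_abs (l n * q n)]; gcongr
    have h3 : 2 * c'.toReal * l n ≤ (l n * q n ^ 2) * l n := by nlinarith
    have := le_of_mul_le_mul_right h3 (hl n)
    linarith

end Yosida

/-! ### Zero extensions, the Poincaré inequality and the energy space. -/

section Basics

variable {N : ℕ} {Ω : Set (E N)} {p : ℝ} {s : E N → E N → ℝ}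

theorem zeroExt_ae_eq_of_ae_eq (hΩ : MeasurableSet Ω) {u : L2 Ω} {f : E N → ℝ}
    (h : u =ᵐ[volume.restrict Ω] f) : zeroExt Ω u =ᵐ[volume] Ω.indicator f := by
  filter_upwards [(ae_restrict_iff' hΩ).1 h] with x hx
  by_cases hxΩ : x ∈ Ω <;> simp [zeroExt, hxΩ, hx]

theorem zeroExt_add (hΩ : MeasurableSet Ω) (u v : L2 Ω) :
    zeroExt Ω (u + v) =ᵐ[volume] zeroExt Ω u + zeroExt Ω v := by
  refine (zeroExt_ae_eq_of_ae_eq hΩ (Lp.coeFn_add u v)).trans (ae_of_all _ fun x => ?_)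
  by_cases hx : x ∈ Ω <;> simp [zeroExt, hx]

theorem zeroExt_sub (hΩ : MeasurableSet Ω) (u v : L2 Ω) :
    zeroExt Ω (u - v) =ᵐ[volume] zeroExt Ω u - zeroExt Ω v := by
  refine (zeroExt_ae_eq_of_ae_eq hΩ (Lp.coeFn_sub u v)).trans (ae_of_all _ fun x => ?_)
  by_cases hx : x ∈ Ω <;> simp [zeroExt, hx]

theorem zeroExt_smul (hΩ : MeasurableSet Ω) (c : ℝ) (u : L2 Ω) :
    zeroExt Ω (c • u) =ᵐ[volume] c • zeroExt Ω u := by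
  refine (zeroExt_ae_eq_of_ae_eq hΩ (Lp.coeFn_smul c u)).trans (ae_of_all _ fun x => ?_)
  by_cases hx : x ∈ Ω <;> simp [zeroExt, hx]

theorem zeroExt_comp (hΩ : MeasurableSet Ω) {q : ℝ → ℝ} (hq0 : q 0 = 0) {u v : L2 Ω}
    (h : v =ᵐ[volume.restrict Ω] q ∘ u) : zeroExt Ω v =ᵐ[volume] q ∘ zeroExt Ω u := by
  refine (zeroExt_ae_eq_of_ae_eq hΩ h).trans (ae_of_all _ fun x => ?_)
  by_cases hx : x ∈ Ω <;> simp [zeroExt, hx, hq0]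

theorem aestronglyMeasurable_zeroExt (hΩ : MeasurableSet Ω) (u : L2 Ω) :
    AEStronglyMeasurable (zeroExt Ω u) volume :=
  (aestronglyMeasurable_indicator_iff hΩ).2 (Lp.aestronglyMeasurable u)

theorem measurableSet_DΩ (hΩ : MeasurableSet Ω) : MeasurableSet (DΩ Ω) :=
  (hΩ.compl.prod hΩ.compl).compl

theorem sigma_absolutelyContinuous : sigma p s Ω ≪ (volume : Measure (E N × E N)) :=
  Measure.restrict_le_self.absolutelyContinuous.trans (withDensity_absolutelyContinuous _ _)

/-- Null sets of `ℝᴺ` pull back to null sets under both projections, and `sigma` is absolutely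
continuous; hence `tilde` respects a.e. classes. -/
theorem tilde_ae_eq {f g : E N → ℝ} (h : f =ᵐ[volume] g) :
    tilde f =ᵐ[sigma p s Ω] tilde g := by
  refine sigma_absolutelyContinuous.ae_le ?_
  have h1 : f ∘ Prod.fst =ᵐ[(volume : Measure (E N × E N))] g ∘ Prod.fst :=
    Measure.quasiMeasurePreserving_fst.ae_eq_comp h
  have h2 : f ∘ Prod.snd =ᵐ[(volume : Measure (E N × E N))] g ∘ Prod.snd :=
    Measure.quasiMeasurePreserving_snd.ae_eq_comp h
  filter_upwards [h1, h2] with z hz1 hz2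
  simp only [Function.comp_apply] at hz1 hz2
  simp [tilde, hz1, hz2]

theorem aestronglyMeasurable_tilde {f : E N → ℝ} (hf : AEStronglyMeasurable f volume) :
    AEStronglyMeasurable (tilde f) (volume : Measure (E N × E N)) :=
  (hf.comp_quasiMeasurePreserving Measure.quasiMeasurePreserving_fst).sub
    (hf.comp_quasiMeasurePreserving Measure.quasiMeasurePreserving_snd)

theorem aestronglyMeasurable_tilde_sigma {f : E N → ℝ} (hf : AEStronglyMeasurable f volume) :
    AEStronglyMeasurable (tilde f) (sigma p s Ω) :=
  (aestronglyMeasurable_tilde hf).mono_ac sigma_absolutelyContinuous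

theorem memLp_ofReal_iff {α : Type*} {m : MeasurableSpace α} {μ : Measure α} {f : α → ℝ}
    (hf : AEStronglyMeasurable f μ) (hp : 0 < p) :
    MemLp f (ENNReal.ofReal p) μ ↔ ∫⁻ x, ENNReal.ofReal (|f x| ^ p) ∂μ < ∞ := by
  rw [MemLp, and_iff_right hf, eLpNorm_lt_top_iff_lintegral_rpow_enorm_lt_top (by simpa) (by simp),
    ENNReal.toReal_ofReal hp.le]
  refine iff_of_eq (congrArg (· < ∞) (lintegral_congr fun x => ?_))
  rw [Real.enorm_eq_ofReal_abs, ENNReal.ofReal_rpow_of_nonneg (abs_nonneg _) hp.le]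

theorem gagliardo_lt_top_iff (hp : 0 < p) {f : E N → ℝ} (hf : AEStronglyMeasurable f volume) :
    gagliardo p s Ω f < ∞ ↔ MemLp (tilde f) (ENNReal.ofReal p) (sigma p s Ω) :=
  (memLp_ofReal_iff (aestronglyMeasurable_tilde_sigma hf) hp).symm

/-- The density of `sigma`. -/
def kernel (p : ℝ) (s : E N → E N → ℝ) (z : E N × E N) : ℝ≥0∞ :=
  ENNReal.ofReal (1 / ‖z.1 - z.2‖ ^ ((N : ℝ) + p * s z.1 z.2))

theorem measurable_kernel (hs : IsVariableOrder s) : Measurable (kernel p s) := by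
  have h1 : Measurable fun z : E N × E N => ‖z.1 - z.2‖ := by fun_prop
  have h2 : Measurable fun z : E N × E N => (N : ℝ) + p * s z.1 z.2 :=
    (continuous_const.add (continuous_const.mul hs.continuous)).measurable
  exact ((h1.pow h2).const_div 1).ennreal_ofReal

theorem gagliardo_eq (hs : IsVariableOrder s) (hΩ : MeasurableSet Ω) {f : E N → ℝ}
    (hf : AEStronglyMeasurable f volume) :
    gagliardo p s Ω f =
      ∫⁻ z in DΩ Ω, kernel p s z * ENNReal.ofReal (|tilde f z| ^ p) := by
  have hm : AEMeasurable (fun z => ENNReal.ofReal (|tilde f z| ^ p))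
      (volume.restrict (DΩ Ω) : Measure (E N × E N)) :=
    (((aestronglyMeasurable_tilde hf).restrict.aemeasurable.abs).pow_const p).ennreal_ofReal
  rw [gagliardo, sigma, restrict_withDensity (measurableSet_DΩ hΩ)]
  exact lintegral_withDensity_eq_lintegral_mul₀ (measurable_kernel hs).aemeasurable hm

/-- A Poincaré inequality: the set `Ω` is bounded and the function vanishes outside of `Ω`. -/
theorem exists_poincare (hN : 1 ≤ N) (hΩ : MeasurableSet Ω) (hΩb : Bornology.IsBounded Ω)
    (hp : 0 < p) (hs : IsVariableOrder s) :
    ∃ c : ℝ≥0∞, c ≠ 0 ∧ ∀ f : E N → ℝ, AEStronglyMeasurable f volume → (∀ x ∉ Ω, f x = 0) →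
      c * ∫⁻ x in Ω, ENNReal.ofReal (|f x| ^ p) ≤ gagliardo p s Ω f := by
  obtain ⟨R, hR0, hR⟩ := hΩb.subset_ball_lt 0 (0 : E N)
  have : Nonempty (Fin N) := ⟨⟨0, hN⟩⟩
  -- The unit ball around a point of norm `R + 1` misses the ball of radius `R` that contains `Ω`.
  -- Points of the two balls are at distance at most `2R + 2`, so the kernel is bounded below on `Ω
  -- ×ˢ B`.
  obtain ⟨y₀, hy₀⟩ := exists_norm_eq (E N) (show (0 : ℝ) ≤ R + 1 by linarith)
  set B := Metric.ball y₀ 1 with hB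
  have hBΩ : B ⊆ Ωᶜ := fun y hy hyΩ => by
    have h1 := hR hyΩ
    rw [hB, Metric.mem_ball, dist_eq_norm] at hy
    rw [Metric.mem_ball, dist_zero_right] at h1
    have := norm_sub_norm_le y₀ y
    rw [norm_sub_rev] at this
    linarith
  set M : ℝ := 2 * R + 2
  set c₀ : ℝ≥0∞ := ENNReal.ofReal (1 / M ^ ((N : ℝ) + p)) with hc₀
  have hM : 1 ≤ M := by simp only [M]; linarith
  have hker : ∀ x ∈ Ω, ∀ y ∈ B, c₀ ≤ kernel p s (x, y) := fun x hx y hy => by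
    have h1 := hR hx
    rw [hB, Metric.mem_ball, dist_eq_norm] at hy
    rw [Metric.mem_ball, dist_zero_right] at h1
    have hxy : 0 < ‖x - y‖ := norm_pos_iff.2 (sub_ne_zero.2 fun h => hBΩ hy (h ▸ hx))
    have hle : ‖x - y‖ ≤ M := by
      have e : x - y = x - y₀ - (y - y₀) := by abel
      have := norm_sub_le (x - y₀) (y - y₀)
      have := norm_sub_le x y₀
      rw [e]; simp only [M]; linarith
    have hsx := hs.mem_Ioo x y
    refine ENNReal.ofReal_le_ofReal (one_div_le_one_div_of_le (by positivity) ?_)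
    calc ‖x - y‖ ^ ((N : ℝ) + p * s x y) ≤ M ^ ((N : ℝ) + p * s x y) :=
          Real.rpow_le_rpow hxy.le hle (by have := hsx.1; positivity)
      _ ≤ M ^ ((N : ℝ) + p) := Real.rpow_le_rpow_of_exponent_le hM (by nlinarith [hsx.2])
  refine ⟨c₀ * volume B, mul_ne_zero ?_ (Metric.measure_ball_pos _ _ one_pos).ne', ?_⟩
  · rw [hc₀, Ne, ENNReal.ofReal_eq_zero, not_le]; positivity
  intro f hf hf0
  rw [gagliardo_eq hs hΩ hf]
  have hsub : Ω ×ˢ B ⊆ DΩ Ω := fun z hz h => h.1 hz.1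
  have hm : AEMeasurable (fun x => ENNReal.ofReal (|f x| ^ p)) (volume.restrict Ω) :=
    ((hf.restrict.aemeasurable.abs).pow_const p).ennreal_ofReal
  calc c₀ * volume B * ∫⁻ x in Ω, ENNReal.ofReal (|f x| ^ p)
      = ∫⁻ z in Ω ×ˢ B, ENNReal.ofReal (|f z.1| ^ p) * c₀ := by
        rw [Measure.volume_eq_prod, ← Measure.prod_restrict,
          lintegral_prod_mul (f := fun x => ENNReal.ofReal (|f x| ^ p)) (g := fun _ => c₀) hm
            aemeasurable_const, setLIntegral_const]
        ring
    _ ≤ ∫⁻ z in Ω ×ˢ B, kernel p s z * ENNReal.ofReal (|tilde f z| ^ p) := by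
        refine setLIntegral_mono' (hΩ.prod measurableSet_ball) fun z hz => ?_
        have e : tilde f z = f z.1 := by rw [tilde, hf0 _ (hBΩ hz.2), sub_zero]
        rw [e, mul_comm]
        gcongr
        exact hker _ hz.1 _ hz.2
    _ ≤ _ := lintegral_mono_set hsub

/-- The `Lᵖ` part of membership, which `L²(Ω)` does not supply when `p > 2`, comes from the Poincaré
inequality. -/
theorem mem_L2X0_iff_gagliardo (hN : 1 ≤ N) (hΩ : MeasurableSet Ω) (hΩb : Bornology.IsBounded Ω)
    (hp : 0 < p) (hs : IsVariableOrder s) {u : L2 Ω} :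
    u ∈ L2X0 p s Ω ↔ gagliardo p s Ω (zeroExt Ω u) < ∞ := by
  refine ⟨fun h => (ENNReal.add_lt_top.1 h.1.2).2, fun h => ?_⟩
  have hmeas := aestronglyMeasurable_zeroExt hΩ u
  obtain ⟨c, hc, hpoin⟩ := exists_poincare hN hΩ hΩb hp hs
  have hfin : ∫⁻ x in Ω, ENNReal.ofReal (|zeroExt Ω u x| ^ p) < ∞ :=
    ENNReal.lt_top_of_mul_ne_top_right
      ((hpoin _ hmeas fun x hx => by simp [zeroExt, hx]).trans_lt h).ne hc
  have heq : ∫⁻ x, ENNReal.ofReal (|zeroExt Ω u x| ^ p) =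
      ∫⁻ x in Ω, ENNReal.ofReal (|zeroExt Ω u x| ^ p) := by
    refine (setLIntegral_eq_of_support_subset fun x hx => ?_).symm
    by_contra hxΩ
    simp [zeroExt, hxΩ, Real.zero_rpow hp.ne'] at hx
  refine ⟨⟨(memLp_ofReal_iff hmeas hp).2 (heq ▸ hfin), ENNReal.add_lt_top.2 ⟨hfin, h⟩⟩, ?_⟩
  exact indicator_ae_eq_restrict_compl hΩ

theorem mem_L2X0_iff (hN : 1 ≤ N) (hΩ : MeasurableSet Ω) (hΩb : Bornology.IsBounded Ω)
    (hp : 0 < p) (hs : IsVariableOrder s) {u : L2 Ω} :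
    u ∈ L2X0 p s Ω ↔ MemLp (tilde (zeroExt Ω u)) (ENNReal.ofReal p) (sigma p s Ω) :=
  (mem_L2X0_iff_gagliardo hN hΩ hΩb hp hs).trans
    (gagliardo_lt_top_iff hp (aestronglyMeasurable_zeroExt hΩ u))

theorem functionalA_eq (hN : 1 ≤ N) (hΩ : MeasurableSet Ω) (hΩb : Bornology.IsBounded Ω)
    (hp : 0 < p) (hs : IsVariableOrder s) (u : L2 Ω) :
    functionalA p s Ω u = ENNReal.ofReal (1 / (2 * p)) * gagliardo p s Ω (zeroExt Ω u) := by
  rw [functionalA]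
  split_ifs with h
  · rfl
  · rw [mem_L2X0_iff_gagliardo hN hΩ hΩb hp hs, not_lt, top_le_iff] at h
    rw [h, ENNReal.mul_top]
    rw [Ne, ENNReal.ofReal_eq_zero, not_le]; positivity

theorem functionalA_ne_top_iff {u : L2 Ω} : functionalA p s Ω u ≠ ∞ ↔ u ∈ L2X0 p s Ω := by
  rw [functionalA]
  split_ifs with h
  · exact iff_of_true (ENNReal.mul_ne_top ENNReal.ofReal_ne_top (ENNReal.add_lt_top.1 h.1.2).2.ne) h
  · simp [h]

theorem tilde_zeroExt_add (hΩ : MeasurableSet Ω) (u v : L2 Ω) :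
    tilde (zeroExt Ω (u + v)) =ᵐ[sigma p s Ω] tilde (zeroExt Ω u) + tilde (zeroExt Ω v) :=
  (tilde_ae_eq (zeroExt_add hΩ u v)).trans (ae_of_all _ fun z => by simp [tilde]; ring)

theorem tilde_zeroExt_sub (hΩ : MeasurableSet Ω) (u v : L2 Ω) :
    tilde (zeroExt Ω (u - v)) =ᵐ[sigma p s Ω] tilde (zeroExt Ω u) - tilde (zeroExt Ω v) :=
  (tilde_ae_eq (zeroExt_sub hΩ u v)).trans (ae_of_all _ fun z => by simp [tilde]; ring)

theorem tilde_zeroExt_smul (hΩ : MeasurableSet Ω) (c : ℝ) (u : L2 Ω) :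
    tilde (zeroExt Ω (c • u)) =ᵐ[sigma p s Ω] c • tilde (zeroExt Ω u) :=
  (tilde_ae_eq (zeroExt_smul hΩ c u)).trans (ae_of_all _ fun z => by simp [tilde]; ring)

/-- `L²(Ω) ∩ X₀` as a linear subspace of `L²(Ω)`. -/
def L2X0Submodule (hN : 1 ≤ N) (hΩ : MeasurableSet Ω) (hΩb : Bornology.IsBounded Ω)
    (hp : 0 < p) (hs : IsVariableOrder s) : Submodule ℝ (L2 Ω) where
  carrier := L2X0 p s Ω
  add_mem' := fun {u v} hu hv => by
    rw [mem_L2X0_iff hN hΩ hΩb hp hs] at *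
    exact (hu.add hv).ae_eq (tilde_zeroExt_add hΩ u v).symm
  zero_mem' := by
    rw [mem_L2X0_iff hN hΩ hΩb hp hs]
    refine (MemLp.zero (ε := ℝ)).ae_eq ?_
    have := tilde_zeroExt_smul (p := p) (s := s) hΩ 0 (0 : L2 Ω)
    rw [zero_smul, zero_smul] at this
    exact this.symm
  smul_mem' := fun c u hu => by
    rw [mem_L2X0_iff hN hΩ hΩb hp hs] at *
    exact (hu.const_smul c).ae_eq (tilde_zeroExt_smul hΩ c u).symm

theorem comp_mem_L2X0 (hN : 1 ≤ N) (hΩ : MeasurableSet Ω) (hΩb : Bornology.IsBounded Ω)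
    (hp : 0 < p) (hs : IsVariableOrder s) {q : ℝ → ℝ} {C : ℝ≥0} (hq : LipschitzWith C q)
    (hq0 : q 0 = 0) {u v : L2 Ω} (hu : u ∈ L2X0 p s Ω) (h : v =ᵐ[volume.restrict Ω] q ∘ u) :
    v ∈ L2X0 p s Ω := by
  rw [mem_L2X0_iff hN hΩ hΩb hp hs] at *
  refine hu.of_le_mul (c := C)
    (aestronglyMeasurable_tilde_sigma (aestronglyMeasurable_zeroExt hΩ v)) ?_
  filter_upwards [tilde_ae_eq (zeroExt_comp hΩ hq0 h)] with z hz
  rw [hz]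
  exact hq.norm_sub_le _ _

end Basics

/-! ### Convexity inequalities for `|a|ᵖ` and its derivative. -/

section PowerDerivative

variable {p : ℝ}

/-- The derivative of `|a|ᵖ / p`. -/
def powDeriv (p a : ℝ) : ℝ := |a| ^ (p - 2) * a

/-- For `p < 2` the factor `|a| ^ (p - 2)` is singular at the origin, so continuity is read off from
the `C¹` function `‖a‖ ^ p`. -/
theorem continuous_powDeriv (hp : 1 < p) : Continuous (powDeriv p) := by
  have h1 := (contDiff_norm_rpow (E := ℝ) hp).continuous_deriv le_rfl
  have h2 : powDeriv p = fun a => p⁻¹ * deriv (fun x : ℝ => ‖x‖ ^ p) a := by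
    funext a
    rw [(hasDerivAt_norm_rpow a hp).deriv, powDeriv, Real.norm_eq_abs]
    field_simp
  rw [h2]
  exact h1.const_mul _

theorem abs_powDeriv (hp : 1 < p) (a : ℝ) : |powDeriv p a| = |a| ^ (p - 1) := by
  rw [powDeriv, abs_mul, abs_of_nonneg (by positivity : (0 : ℝ) ≤ |a| ^ (p - 2))]
  rcases eq_or_ne a 0 with rfl | ha
  · simp [Real.zero_rpow (sub_pos.2 hp).ne']
  · rw [← Real.rpow_add_one (abs_ne_zero.2 ha)]; congr 1; ring

theorem powDeriv_mul_self (hp : 1 < p) (a : ℝ) : powDeriv p a * a = |a| ^ p := by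
  rw [powDeriv]
  rcases eq_or_ne a 0 with rfl | ha
  · simp [Real.zero_rpow (zero_lt_one.trans hp).ne']
  · rw [mul_assoc, ← abs_mul_abs_self a, ← mul_assoc, ← Real.rpow_add_one (abs_ne_zero.2 ha),
      ← Real.rpow_add_one (abs_ne_zero.2 ha)]
    congr 1; ring

/-- Young's inequality with the exact constants: it is an equality at `b = a`, which is what turns
it into the tangent line inequality `abs_rpow_add_le`. -/
theorem young_powDeriv (hp : 1 < p) (a b : ℝ) :
    p * (powDeriv p a * b) ≤ (p - 1) * |a| ^ p + |b| ^ p := by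
  have hconj := Real.HolderConjugate.conjExponent hp
  have h1 := Real.young_inequality_of_nonneg (abs_nonneg b) (abs_nonneg (powDeriv p a)) hconj
  have h2 : |powDeriv p a| ^ p.conjExponent = |a| ^ p := by
    rw [abs_powDeriv hp, ← Real.rpow_mul (abs_nonneg a), hconj.sub_one_mul_conj]
  have h3 : (p.conjExponent)⁻¹ = (p - 1) / p := by
    rw [Real.conjExponent, inv_div]
  rw [h2, div_eq_mul_inv _ p.conjExponent, h3] at h1
  have h4 : powDeriv p a * b ≤ |b| * |powDeriv p a| := by
    rw [mul_comm, ← abs_mul]; exact le_abs_self _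
  have h5 := mul_le_mul_of_nonneg_left (h4.trans h1) (by linarith : 0 ≤ p)
  refine h5.trans (le_of_eq ?_)
  have : p ≠ 0 := by linarith
  field_simp
  ring

theorem abs_powDeriv_mul_le (hp : 1 < p) (a b : ℝ) : |powDeriv p a * b| ≤ |a| ^ p + |b| ^ p := by
  have h1 := young_powDeriv hp a b
  have h2 := young_powDeriv hp a (-b)
  rw [abs_neg] at h2
  have ha : 0 ≤ |a| ^ p := by positivity
  have hb : 0 ≤ |b| ^ p := by positivity
  rw [abs_le]
  constructor <;> nlinarith

theorem abs_rpow_add_le (hp : 1 < p) (a b : ℝ) :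
    |a| ^ p + p * (powDeriv p a * (b - a)) ≤ |b| ^ p := by
  have h1 := young_powDeriv hp a b
  have h2 := powDeriv_mul_self hp a
  nlinarith

theorem powDeriv_monotone (hp : 1 < p) (a b : ℝ) :
    0 ≤ (powDeriv p a - powDeriv p b) * (a - b) := by
  have h1 := abs_rpow_add_le hp a b
  have h2 := abs_rpow_add_le hp b a
  have : 0 ≤ p * ((powDeriv p a - powDeriv p b) * (a - b)) := by linarith
  exact nonneg_of_mul_nonneg_right this (by linarith)

theorem abs_rpow_convex (hp : 1 < p) {α β : ℝ} (hα : 0 ≤ α) (hβ : 0 ≤ β) (hαβ : α + β = 1)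
    (x y : ℝ) : |α * x + β * y| ^ p ≤ α * |x| ^ p + β * |y| ^ p := by
  set a := α * x + β * y with ha
  have h1 := mul_le_mul_of_nonneg_left (abs_rpow_add_le hp a x) hα
  have h2 := mul_le_mul_of_nonneg_left (abs_rpow_add_le hp a y) hβ
  have h3 : α * (|a| ^ p + p * (powDeriv p a * (x - a))) + β * (|a| ^ p + p * (powDeriv p a * (y - a)))
      = |a| ^ p := by
    have : α * (x - a) + β * (y - a) = 0 := by
      linear_combination (-a) * hαβ - ha
    linear_combination |a| ^ p * hαβ + p * powDeriv p a * this
  linarith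

variable {α : Type*} {m : MeasurableSpace α} {μ : Measure α} {U V : α → ℝ}

theorem integrable_abs_rpow (hp : 1 < p) (hU : MemLp U (ENNReal.ofReal p) μ) :
    Integrable (fun z => |U z| ^ p) μ := by
  have := hU.integrable_norm_rpow (by simp; linarith) (by simp)
  rwa [ENNReal.toReal_ofReal (by linarith)] at this

theorem integrable_powDeriv_mul (hp : 1 < p) (hU : MemLp U (ENNReal.ofReal p) μ)
    (hV : MemLp V (ENNReal.ofReal p) μ) : Integrable (fun z => powDeriv p (U z) * V z) μ := by
  refine ((integrable_abs_rpow hp hU).add (integrable_abs_rpow hp hV)).mono'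
    (((continuous_powDeriv hp).comp_aestronglyMeasurable hU.1).mul hV.1) (ae_of_all _ fun z => ?_)
  exact abs_powDeriv_mul_le hp _ _

theorem tendsto_integral_powDeriv (hp : 1 < p) (hU : MemLp U (ENNReal.ofReal p) μ)
    (hV : MemLp V (ENNReal.ofReal p) μ) :
    Tendsto (fun n : ℕ => ∫ z, powDeriv p (U z + (1 / (n + 1 : ℝ)) * V z) * V z ∂μ) atTop
      (𝓝 (∫ z, powDeriv p (U z) * V z ∂μ)) := by
  have hUV : MemLp (fun z => |U z| + |V z|) (ENNReal.ofReal p) μ := hU.norm.add hV.norm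
  refine tendsto_integral_of_dominated_convergence
    (fun z => |(|U z| + |V z|)| ^ p + |V z| ^ p) (fun n => ?_)
    ((integrable_abs_rpow hp hUV).add (integrable_abs_rpow hp hV))
    (fun n => ae_of_all _ fun z => ?_) (ae_of_all _ fun z => ?_)
  · exact ((continuous_powDeriv hp).comp_aestronglyMeasurable
      (hU.1.add (hV.1.const_mul _))).mul hV.1
  · refine (abs_powDeriv_mul_le hp _ _).trans (add_le_add (Real.rpow_le_rpow (abs_nonneg _) ?_
      (by linarith)) le_rfl)
    rw [abs_of_nonneg (by positivity : 0 ≤ |U z| + |V z|)]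
    refine (abs_add_le _ _).trans (add_le_add le_rfl ?_)
    rw [abs_mul, abs_of_pos (by positivity : (0 : ℝ) < 1 / (n + 1 : ℝ))]
    refine mul_le_of_le_one_left (abs_nonneg _) ?_
    rw [div_le_one (by positivity)]
    linarith [n.cast_nonneg (α := ℝ)]
  · have h1 : Tendsto (fun n : ℕ => U z + (1 / (n + 1 : ℝ)) * V z) atTop (𝓝 (U z)) := by
      simpa using ((tendsto_one_div_add_atTop_nhds_zero_nat (𝕜 := ℝ)).mul_const (V z)).const_add (U z)
    exact (((continuous_powDeriv hp).tendsto _).comp h1).mul_const _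

end PowerDerivative

/-! ### Convexity and lower semicontinuity of the functional, and its subdifferential. -/

section Functional

variable {N : ℕ} {Ω : Set (E N)} {p : ℝ} {s : E N → E N → ℝ}

theorem gagliardo_congr {f g : E N → ℝ} (h : tilde f =ᵐ[sigma p s Ω] tilde g) :
    gagliardo p s Ω f = gagliardo p s Ω g :=
  lintegral_congr_ae (h.mono fun z hz => by simp only [hz])

theorem functionalA_toReal (hN : 1 ≤ N) (hΩ : MeasurableSet Ω) (hΩb : Bornology.IsBounded Ω)
    (hp : 1 < p) (hs : IsVariableOrder s) (u : L2 Ω) :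
    (functionalA p s Ω u).toReal =
      1 / (2 * p) * ∫ z, |tilde (zeroExt Ω u) z| ^ p ∂(sigma p s Ω) := by
  have hm := aestronglyMeasurable_tilde_sigma (p := p) (s := s) (Ω := Ω)
    (aestronglyMeasurable_zeroExt hΩ u)
  rw [functionalA_eq hN hΩ hΩb (by linarith) hs, ENNReal.toReal_mul,
    ENNReal.toReal_ofReal (by positivity), gagliardo,
    integral_eq_lintegral_of_nonneg_ae (ae_of_all _ fun z => by positivity)
      (hm.aemeasurable.abs.pow_const p).aestronglyMeasurable]

theorem convexOn_functionalA (hN : 1 ≤ N) (hΩ : MeasurableSet Ω) (hΩb : Bornology.IsBounded Ω)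
    (hp : 1 < p) (hs : IsVariableOrder s) : ConvexOn ℝ≥0 univ (functionalA p s Ω) := by
  refine ⟨convex_univ, fun u _ v _ a b _ _ hab => ?_⟩
  have hp0 : 0 < p := by linarith
  have hm := fun w => (aestronglyMeasurable_tilde_sigma (p := p) (s := s) (Ω := Ω)
    (aestronglyMeasurable_zeroExt hΩ w))
  simp only [functionalA_eq hN hΩ hΩb hp0 hs, ENNReal.smul_def, smul_eq_mul, NNReal.smul_def]
  rw [mul_left_comm, mul_left_comm (b : ℝ≥0∞), ← mul_add]
  gcongr
  have hae : tilde (zeroExt Ω ((a : ℝ) • u + (b : ℝ) • v)) =ᵐ[sigma p s Ω]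
      fun z => (a : ℝ) * tilde (zeroExt Ω u) z + (b : ℝ) * tilde (zeroExt Ω v) z := by
    filter_upwards [tilde_zeroExt_add (p := p) (s := s) hΩ ((a : ℝ) • u) ((b : ℝ) • v),
      tilde_zeroExt_smul (p := p) (s := s) hΩ a u, tilde_zeroExt_smul (p := p) (s := s) hΩ b v]
      with z h1 h2 h3
    rw [h1, Pi.add_apply, h2, h3]; rfl
  have hmeas : ∀ w, AEMeasurable (fun z => ENNReal.ofReal (|tilde (zeroExt Ω w) z| ^ p))
      (sigma p s Ω) := fun w => ((hm w).aemeasurable.abs.pow_const p).ennreal_ofReal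
  simp only [gagliardo]
  rw [← lintegral_const_mul'' _ (hmeas u), ← lintegral_const_mul'' _ (hmeas v),
    ← lintegral_add_left' ((hmeas u).const_mul _)]
  refine lintegral_mono_ae (hae.mono fun z hz => ?_)
  rw [hz, ← ENNReal.ofReal_coe_nnreal, ← ENNReal.ofReal_coe_nnreal,
    ← ENNReal.ofReal_mul a.coe_nonneg, ← ENNReal.ofReal_mul b.coe_nonneg,
    ← ENNReal.ofReal_add (by positivity) (by positivity)]
  exact ENNReal.ofReal_le_ofReal (abs_rpow_convex hp a.coe_nonneg b.coe_nonneg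
    (by exact_mod_cast hab) _ _)

/-- An `L²` convergent sequence has an a.e. convergent subsequence, and Fatou's lemma for `sigma`
bounds the energy of the limit. -/
theorem lowerSemicontinuous_functionalA (hN : 1 ≤ N) (hΩ : MeasurableSet Ω)
    (hΩb : Bornology.IsBounded Ω) (hp : 1 < p) (hs : IsVariableOrder s) :
    LowerSemicontinuous (functionalA p s Ω) := by
  refine lowerSemicontinuous_iff_isClosed_preimage.2 fun c => ?_
  refine IsSeqClosed.isClosed fun u u₀ hu hlim => ?_
  have hm := fun w => (aestronglyMeasurable_tilde_sigma (p := p) (s := s) (Ω := Ω)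
    (aestronglyMeasurable_zeroExt hΩ w))
  obtain ⟨ns, -, hns⟩ := (tendstoInMeasure_of_tendsto_Lp hlim).exists_seq_tendsto_ae
  have hext : ∀ᵐ x ∂(volume : Measure (E N)),
      Tendsto (fun i => zeroExt Ω (u (ns i)) x) atTop (𝓝 (zeroExt Ω u₀ x)) := by
    filter_upwards [(ae_restrict_iff' hΩ).1 hns] with x hx
    by_cases hxΩ : x ∈ Ω
    · simpa [zeroExt, hxΩ] using hx hxΩ
    · simp [zeroExt, hxΩ]
  have htil : ∀ᵐ z ∂(sigma p s Ω),
      Tendsto (fun i => tilde (zeroExt Ω (u (ns i))) z) atTop (𝓝 (tilde (zeroExt Ω u₀) z)) := by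
    refine sigma_absolutelyContinuous.ae_le ?_
    filter_upwards [Measure.quasiMeasurePreserving_fst.ae hext,
      Measure.quasiMeasurePreserving_snd.ae hext] with z h1 h2 using h1.sub h2
  simp only [mem_preimage, mem_Iic, functionalA_eq hN hΩ hΩb (by linarith : 0 < p) hs] at hu ⊢
  have hmeas : ∀ w, AEMeasurable (fun z => ENNReal.ofReal (|tilde (zeroExt Ω w) z| ^ p))
      (sigma p s Ω) := fun w => ((hm w).aemeasurable.abs.pow_const p).ennreal_ofReal
  simp only [gagliardo] at hu ⊢
  rw [← lintegral_const_mul'' _ (hmeas _)]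
  calc _ ≤ ∫⁻ z, liminf (fun i => ENNReal.ofReal (1 / (2 * p)) *
          ENNReal.ofReal (|tilde (zeroExt Ω (u (ns i))) z| ^ p)) atTop ∂(sigma p s Ω) := by
        refine lintegral_mono_ae (htil.mono fun z hz => le_of_eq ?_)
        have h1 := (ENNReal.continuous_ofReal.tendsto _).comp
          ((hz.abs).rpow_const (p := p) (Or.inr (by linarith)))
        exact (ENNReal.Tendsto.const_mul h1 (Or.inr ENNReal.ofReal_ne_top)).liminf_eq.symm
    _ ≤ liminf (fun i => ∫⁻ z, ENNReal.ofReal (1 / (2 * p)) *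
          ENNReal.ofReal (|tilde (zeroExt Ω (u (ns i))) z| ^ p) ∂(sigma p s Ω)) atTop :=
        lintegral_liminf_le' fun i => (hmeas _).const_mul _
    _ ≤ c := by
        refine liminf_le_of_frequently_le' (Frequently.of_forall fun i => ?_)
        rw [lintegral_const_mul'' _ (hmeas _)]
        exact hu _

theorem inner_L2_eq (u v : L2 Ω) : inner ℝ u v = ∫ x in Ω, u x * v x := by
  rw [L2.inner_def]
  exact integral_congr_ae (ae_of_all _ fun x => by simp [mul_comm])

theorem mem_operatorA_iff {u v : L2 Ω} : (u, v) ∈ operatorA p s Ω ↔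
    u ∈ L2X0 p s Ω ∧ ∀ φ ∈ L2X0 p s Ω, inner ℝ v φ =
      1 / 2 * ∫ z, powDeriv p (tilde (zeroExt Ω u) z) * tilde (zeroExt Ω φ) z ∂(sigma p s Ω) := by
  simp only [inner_L2_eq, powDeriv]
  rfl

theorem operatorA_subset_subdifferential (hN : 1 ≤ N) (hΩ : MeasurableSet Ω)
    (hΩb : Bornology.IsBounded Ω) (hp : 1 < p) (hs : IsVariableOrder s) :
    operatorA p s Ω ⊆ subdifferential (functionalA p s Ω) := by
  rintro ⟨u, v⟩ h
  have hp0 : 0 < p := by linarith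
  obtain ⟨hu, heq⟩ := mem_operatorA_iff.1 h
  refine mem_subdifferential_iff.2 ⟨functionalA_ne_top_iff.2 hu, fun w hw => ?_⟩
  rw [functionalA_ne_top_iff] at hw
  rw [heq _ ((L2X0Submodule hN hΩ hΩb hp0 hs).sub_mem hw hu),
    functionalA_toReal hN hΩ hΩb hp hs, functionalA_toReal hN hΩ hΩb hp hs]
  rw [mem_L2X0_iff hN hΩ hΩb hp0 hs] at hu hw
  have hae : (fun z => powDeriv p (tilde (zeroExt Ω u) z) * tilde (zeroExt Ω (w - u)) z)
      =ᵐ[sigma p s Ω] fun z => powDeriv p (tilde (zeroExt Ω u) z) *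
        (tilde (zeroExt Ω w) - tilde (zeroExt Ω u)) z := by
    filter_upwards [tilde_zeroExt_sub (p := p) (s := s) hΩ w u] with z hz
    rw [hz]
  rw [integral_congr_ae hae]
  have hi := integrable_powDeriv_mul hp hu (hw.sub hu)
  have h1 := integral_mono ((integrable_abs_rpow hp hu).add (hi.const_mul p))
    (integrable_abs_rpow hp hw) fun z => abs_rpow_add_le hp (tilde (zeroExt Ω u) z)
      (tilde (zeroExt Ω w) z)
  simp only [Pi.add_apply] at h1
  rw [integral_add (integrable_abs_rpow hp hu) (hi.const_mul p), integral_const_mul] at h1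
  have h2 := mul_le_mul_of_nonneg_left h1 (by positivity : 0 ≤ 1 / (2 * p))
  refine le_trans (le_of_eq ?_) h2
  field_simp

/-- Perturbing `u` to `u + tφ` bounds `⟨v, φ⟩` by a difference quotient of the functional, whose
limit as `t → 0` is the integral on the right. Applying this to `-φ` as well gives equality. -/
theorem subdifferential_inner_le (hN : 1 ≤ N) (hΩ : MeasurableSet Ω)
    (hΩb : Bornology.IsBounded Ω) (hp : 1 < p) (hs : IsVariableOrder s) {u v φ : L2 Ω}
    (h : (u, v) ∈ subdifferential (functionalA p s Ω)) (hφ : φ ∈ L2X0 p s Ω) :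
    inner ℝ v φ ≤
      1 / 2 * ∫ z, powDeriv p (tilde (zeroExt Ω u) z) * tilde (zeroExt Ω φ) z ∂(sigma p s Ω) := by
  have hp0 : 0 < p := by linarith
  obtain ⟨hu, hle⟩ := mem_subdifferential_iff.1 h
  rw [functionalA_ne_top_iff] at hu
  have hU := (mem_L2X0_iff hN hΩ hΩb hp0 hs).1 hu
  have hV := (mem_L2X0_iff hN hΩ hΩb hp0 hs).1 hφ
  refine ge_of_tendsto ((tendsto_integral_powDeriv hp hU hV).const_mul (1 / 2))
    (Eventually.of_forall fun n => ?_)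
  set t : ℝ := 1 / (n + 1 : ℝ) with ht
  have ht0 : 0 < t := by positivity
  have hmem : u + t • φ ∈ L2X0 p s Ω :=
    (L2X0Submodule hN hΩ hΩb hp0 hs).add_mem hu
      ((L2X0Submodule hN hΩ hΩb hp0 hs).smul_mem t hφ)
  have h1 := hle _ (functionalA_ne_top_iff.2 hmem)
  rw [functionalA_toReal hN hΩ hΩb hp hs, functionalA_toReal hN hΩ hΩb hp hs,
    add_sub_cancel_left, inner_smul_right] at h1
  have hW : MemLp (fun z => tilde (zeroExt Ω u) z + t * tilde (zeroExt Ω φ) z)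
      (ENNReal.ofReal p) (sigma p s Ω) := hU.add (hV.const_mul t)
  have hae : ∀ᵐ z ∂(sigma p s Ω), |tilde (zeroExt Ω (u + t • φ)) z| ^ p =
      |tilde (zeroExt Ω u) z + t * tilde (zeroExt Ω φ) z| ^ p := by
    filter_upwards [tilde_zeroExt_add (p := p) (s := s) hΩ u (t • φ),
      tilde_zeroExt_smul (p := p) (s := s) hΩ t φ] with z h1 h2
    rw [h1, Pi.add_apply, h2]; rfl
  rw [integral_congr_ae hae] at h1
  have hi := integrable_powDeriv_mul hp hW hV
  -- The tangent inequality is based at the perturbed point and evaluated at `u`, so it bounds the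
  -- increment from above.
  have h2 := integral_mono ((integrable_abs_rpow hp hW).sub (hi.const_mul (p * t)))
    (integrable_abs_rpow hp hU) fun z => by
      have := abs_rpow_add_le hp (tilde (zeroExt Ω u) z + t * tilde (zeroExt Ω φ) z)
        (tilde (zeroExt Ω u) z)
      refine le_trans (le_of_eq ?_) this
      simp only [Pi.sub_apply]
      ring
  simp only [Pi.sub_apply] at h2
  rw [integral_sub (integrable_abs_rpow hp hW) (hi.const_mul (p * t)), integral_const_mul] at h2
  have h3 := mul_le_mul_of_nonneg_left h2 (by positivity : 0 ≤ 1 / (2 * p))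
  refine le_of_mul_le_mul_left ?_ ht0
  have e : ∀ I : ℝ, 1 / (2 * p) * (p * t * I) = t * (1 / 2 * I) := fun I => by field_simp
  rw [mul_sub, e] at h3
  linarith

theorem operatorA_eq_subdifferential (hN : 1 ≤ N) (hΩ : MeasurableSet Ω)
    (hΩb : Bornology.IsBounded Ω) (hp : 1 < p) (hs : IsVariableOrder s) :
    operatorA p s Ω = subdifferential (functionalA p s Ω) := by
  refine (operatorA_subset_subdifferential hN hΩ hΩb hp hs).antisymm ?_
  rintro ⟨u, v⟩ h
  have hp0 : 0 < p := by linarith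
  refine mem_operatorA_iff.2 ⟨functionalA_ne_top_iff.1 (mem_subdifferential_iff.1 h).1,
    fun φ hφ => le_antisymm (subdifferential_inner_le hN hΩ hΩb hp hs h hφ) ?_⟩
  have h1 := subdifferential_inner_le hN hΩ hΩb hp hs h
    ((L2X0Submodule hN hΩ hΩb hp0 hs).smul_mem (-1) hφ)
  have hae : (fun z => powDeriv p (tilde (zeroExt Ω u) z) * tilde (zeroExt Ω ((-1 : ℝ) • φ)) z)
      =ᵐ[sigma p s Ω] fun z => -(powDeriv p (tilde (zeroExt Ω u) z) * tilde (zeroExt Ω φ) z) := by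
    filter_upwards [tilde_zeroExt_smul (p := p) (s := s) hΩ (-1) φ] with z hz
    rw [hz, Pi.smul_apply, smul_eq_mul]
    ring
  rw [integral_congr_ae hae, integral_neg, inner_smul_right] at h1
  linarith

end Functional

/-! ### Test functions have finite energy, hence the energy space is dense. -/

section Density

variable {N : ℕ} {Ω : Set (E N)} {p : ℝ} {s : E N → E N → ℝ}

/-- A radial majorant of the kernel tested with a bounded Lipschitz function. -/
def radialMajorant (N : ℕ) (a b r : ℝ) : ℝ :=
  if r ≤ 1 then r ^ (a - N) else r ^ (-b - N)

theorem integrable_radialMajorant (hN : 1 ≤ N) {a b : ℝ} (ha : 0 < a) (hb : 0 < b) :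
    Integrable (fun x : E N => radialMajorant N a b ‖x‖) volume := by
  have : Nonempty (Fin N) := ⟨⟨0, hN⟩⟩
  have hpow : ∀ c y : ℝ, 0 < y → y ^ (N - 1) • y ^ (c - N) = y ^ (c - 1) := fun c y hy => by
    rw [smul_eq_mul, ← Real.rpow_natCast, ← Real.rpow_add hy, Nat.cast_sub hN]
    congr 1; push_cast; ring
  rw [integrable_fun_norm_addHaar (volume : Measure (E N)) (f := radialMajorant N a b),
    finrank_euclideanSpace_fin,
    ← Ioc_union_Ioi_eq_Ioi (zero_le_one (α := ℝ))]
  refine IntegrableOn.union ?_ ?_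
  · have h1 : IntegrableOn (fun y : ℝ => y ^ (a - 1)) (Ioc 0 1) :=
      (intervalIntegrable_iff_integrableOn_Ioc_of_le zero_le_one).1
        (intervalIntegral.intervalIntegrable_rpow' (by linarith))
    refine h1.congr_fun (fun y hy => ?_) measurableSet_Ioc
    simp only [radialMajorant, if_pos hy.2, hpow _ _ hy.1]
  · refine (integrableOn_Ioi_rpow_of_lt (by linarith : -b - 1 < -1) one_pos).congr_fun
      (fun y (hy : 1 < y) => ?_) measurableSet_Ioi
    simp only [radialMajorant, if_neg hy.not_ge, hpow _ _ (one_pos.trans hy)]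

/-- Near the diagonal the Lipschitz bound beats the singularity because `sup s < 1`; far from it
boundedness of `g` suffices because `inf s > 0`. -/
theorem kernel_mul_le (hp : 0 < p) (hs : IsVariableOrder s) {g : E N → ℝ} {L : ℝ≥0}
    (hL : LipschitzWith L g) {M : ℝ} (hM : ∀ x, |g x| ≤ M) (z : E N × E N) :
    kernel p s z * ENNReal.ofReal (|tilde g z| ^ p) ≤
      ENNReal.ofReal (((L : ℝ) ^ p + (2 * M) ^ p) * radialMajorant N
        (p * (1 - ⨆ z : E N × E N, s z.1 z.2)) (p * ⨅ z : E N × E N, s z.1 z.2) ‖z.1 - z.2‖) := by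
  set S := ⨆ z : E N × E N, s z.1 z.2
  set I := ⨅ z : E N × E N, s z.1 z.2
  have hsS : s z.1 z.2 ≤ S := le_ciSup (f := fun z : E N × E N => s z.1 z.2)
    ⟨1, by rintro _ ⟨w, rfl⟩; exact (hs.mem_Ioo _ _).2.le⟩ z
  have hIs : I ≤ s z.1 z.2 := ciInf_le (f := fun z : E N × E N => s z.1 z.2)
    ⟨0, by rintro _ ⟨w, rfl⟩; exact (hs.mem_Ioo _ _).1.le⟩ z
  have hM0 : 0 ≤ M := (abs_nonneg _).trans (hM 0)
  have hspos := (hs.mem_Ioo z.1 z.2).1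
  rw [kernel, ← ENNReal.ofReal_mul (by positivity)]
  refine ENNReal.ofReal_le_ofReal ?_
  -- On the diagonal the kernel is `1 / 0 = 0`, so the left side vanishes.
  rcases (norm_nonneg (z.1 - z.2)).eq_or_lt with h0 | hr
  · rw [← h0, Real.zero_rpow (by positivity), div_zero, zero_mul, radialMajorant,
      if_pos zero_le_one]
    positivity
  have hlip : |tilde g z| ≤ L * ‖z.1 - z.2‖ := hL.norm_sub_le z.1 z.2
  have hbd : |tilde g z| ≤ 2 * M := by
    have := abs_sub (g z.1) (g z.2)
    have h1 := hM z.1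
    have h2 := hM z.2
    simp only [tilde]; linarith
  set r := ‖z.1 - z.2‖
  have hLp : 0 ≤ (L : ℝ) ^ p := by positivity
  have hMp : 0 ≤ (2 * M) ^ p := by positivity
  rw [radialMajorant, one_div, ← Real.rpow_neg hr.le]
  split_ifs with hr1
  · calc r ^ (-((N : ℝ) + p * s z.1 z.2)) * |tilde g z| ^ p
        ≤ r ^ (-((N : ℝ) + p * s z.1 z.2)) * (L * r) ^ p := by gcongr
      _ = (L : ℝ) ^ p * r ^ (p - p * s z.1 z.2 - N) := by
          rw [Real.mul_rpow L.coe_nonneg hr.le, mul_left_comm, ← Real.rpow_add hr]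
          congr 2; ring
      _ ≤ (L : ℝ) ^ p * r ^ (p * (1 - S) - N) := by
          refine mul_le_mul_of_nonneg_left ?_ hLp
          exact Real.rpow_le_rpow_of_exponent_ge hr hr1 (by nlinarith)
      _ ≤ _ := by gcongr; linarith
  · rw [not_le] at hr1
    calc r ^ (-((N : ℝ) + p * s z.1 z.2)) * |tilde g z| ^ p
        ≤ r ^ (-(p * I) - N) * (2 * M) ^ p := by
          refine mul_le_mul ?_ (Real.rpow_le_rpow (abs_nonneg _) hbd hp.le) (by positivity)
            (by positivity)
          exact Real.rpow_le_rpow_of_exponent_le hr1.le (by nlinarith)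
      _ = (2 * M) ^ p * r ^ (-(p * I) - N) := mul_comm _ _
      _ ≤ _ := by gcongr; linarith

theorem gagliardo_lt_top_of_lipschitz (hN : 1 ≤ N) (hΩ : MeasurableSet Ω)
    (hΩb : Bornology.IsBounded Ω) (hp : 0 < p) (hs : IsVariableOrder s) {g : E N → ℝ} {L : ℝ≥0}
    (hL : LipschitzWith L g) {M : ℝ} (hM : ∀ x, |g x| ≤ M) : gagliardo p s Ω g < ∞ := by
  set a := p * (1 - ⨆ z : E N × E N, s z.1 z.2)
  set b := p * ⨅ z : E N × E N, s z.1 z.2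
  set C := (L : ℝ) ^ p + (2 * M) ^ p
  have hint : Integrable (fun x : E N => C * radialMajorant N a b ‖x‖) volume :=
    (integrable_radialMajorant hN (mul_pos hp (by linarith [hs.sup_lt_one]))
      (mul_pos hp hs.inf_pos)).const_mul _
  set K : E N → ℝ≥0∞ := fun x => ENNReal.ofReal (C * radialMajorant N a b ‖x‖) with hK
  have hKfin : ∫⁻ x, K x < ∞ := hint.lintegral_lt_top
  have hKm : Measurable K := by
    have : Measurable (radialMajorant N a b) :=
      Measurable.ite measurableSet_Iic (measurable_id.pow_const _) (measurable_id.pow_const _)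
    exact ((this.comp measurable_norm).const_mul C).ennreal_ofReal
  have hKm2 : Measurable fun z : E N × E N => K (z.1 - z.2) :=
    hKm.comp (measurable_fst.sub measurable_snd)
  have hvol : volume Ω < ∞ := hΩb.measure_lt_top
  rw [gagliardo_eq hs hΩ hL.continuous.aestronglyMeasurable]
  -- One variable of each pair lies in `Ω`. Integrating the other over all of `ℝᴺ` gives `∫ K` by
  -- invariance, and the remaining factor is the finite volume of `Ω`.
  have hsub : DΩ Ω ⊆ Ω ×ˢ univ ∪ univ ×ˢ Ω := fun z hz => by
    by_contra h
    simp only [mem_union, mem_prod, mem_univ, and_true, true_and, not_or] at h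
    exact hz ⟨h.1, h.2⟩
  have h1 : ∫⁻ z in Ω ×ˢ (univ : Set (E N)), K (z.1 - z.2) = (∫⁻ x, K x) * volume Ω := by
    rw [Measure.volume_eq_prod, ← Measure.prod_restrict, lintegral_prod _ hKm2.aemeasurable,
      Measure.restrict_univ]
    simp only [lintegral_sub_left_eq_self K]
    rw [lintegral_const, Measure.restrict_apply_univ]
  have h2 : ∫⁻ z in (univ : Set (E N)) ×ˢ Ω, K (z.1 - z.2) = (∫⁻ x, K x) * volume Ω := by
    rw [Measure.volume_eq_prod, ← Measure.prod_restrict, lintegral_prod_symm _ hKm2.aemeasurable,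
      Measure.restrict_univ]
    simp only [lintegral_sub_right_eq_self K]
    rw [lintegral_const, Measure.restrict_apply_univ]
  calc ∫⁻ z in DΩ Ω, kernel p s z * ENNReal.ofReal (|tilde g z| ^ p)
      ≤ ∫⁻ z in DΩ Ω, K (z.1 - z.2) := lintegral_mono fun z => kernel_mul_le hp hs hL hM z
    _ ≤ ∫⁻ z in Ω ×ˢ univ ∪ univ ×ˢ Ω, K (z.1 - z.2) := lintegral_mono_set hsub
    _ ≤ _ := lintegral_union_le _ _ _
    _ < ∞ := by
      rw [h1, h2]
      exact ENNReal.add_lt_top.2 ⟨ENNReal.mul_lt_top hKfin hvol, ENNReal.mul_lt_top hKfin hvol⟩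

theorem exists_mem_L2X0_of_contDiff (hN : 1 ≤ N) (hΩ : MeasurableSet Ω)
    (hΩb : Bornology.IsBounded Ω) (hp : 0 < p) (hs : IsVariableOrder s) {g : E N → ℝ}
    (hg : ContDiff ℝ 1 g) (hgc : HasCompactSupport g) (hgΩ : tsupport g ⊆ Ω) :
    ∃ v ∈ L2X0 p s Ω, v =ᵐ[volume.restrict Ω] g := by
  have hmem : MemLp g 2 (volume.restrict Ω) :=
    (hg.continuous.memLp_of_hasCompactSupport hgc).restrict Ω
  refine ⟨hmem.toLp g, ?_, hmem.coeFn_toLp⟩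
  rw [mem_L2X0_iff_gagliardo hN hΩ hΩb hp hs]
  have hae : zeroExt Ω (hmem.toLp g) =ᵐ[volume] g := by
    refine (zeroExt_ae_eq_of_ae_eq hΩ hmem.coeFn_toLp).trans (ae_of_all _ fun x => ?_)
    exact congrFun (indicator_eq_self.2 ((subset_tsupport g).trans hgΩ)) x
  rw [gagliardo_congr (tilde_ae_eq hae)]
  obtain ⟨L, hL⟩ := hg.lipschitzWith_of_hasCompactSupport hgc one_ne_zero
  obtain ⟨M, hM⟩ := hgc.exists_bound_of_continuous hg.continuous
  exact gagliardo_lt_top_of_lipschitz hN hΩ hΩb hp hs hL hM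

/-- A vector orthogonal to the subspace annihilates every smooth function compactly supported in
`Ω`, hence vanishes a.e. there. -/
theorem dense_L2X0 (hN : 1 ≤ N) (hΩo : IsOpen Ω) (hΩb : Bornology.IsBounded Ω) (hp : 0 < p)
    (hs : IsVariableOrder s) : Dense (L2X0 p s Ω) := by
  have hΩ := hΩo.measurableSet
  have hfinite : IsFiniteMeasure (volume.restrict Ω) :=
    isFiniteMeasure_restrict.2 hΩb.measure_lt_top.ne
  change Dense (L2X0Submodule hN hΩ hΩb hp hs : Set (L2 Ω))
  rw [Submodule.dense_iff_topologicalClosure_eq_top, Submodule.topologicalClosure_eq_top_iff,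
    Submodule.eq_bot_iff]
  intro f hf
  have hfint : IntegrableOn f Ω volume := (Lp.memLp f).integrable one_le_two
  have hzero := hΩo.ae_eq_zero_of_integral_contDiff_smul_eq_zero hfint.locallyIntegrableOn
    fun g hg hgc hgΩ => by
      obtain ⟨v, hv, hvg⟩ := exists_mem_L2X0_of_contDiff hN hΩ hΩb hp hs (hg.of_le (by simp)) hgc hgΩ
      have h1 : inner ℝ v f = 0 := (Submodule.mem_orthogonal _ _).1 hf v hv
      have hae : (fun x => v x * f x) =ᵐ[volume.restrict Ω] fun x => g x * f x :=
        hvg.mul (ae_eq_refl _)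
      rw [inner_L2_eq, integral_congr_ae hae] at h1
      rw [← h1]
      refine (setIntegral_eq_integral_of_forall_compl_eq_zero fun x hx => ?_).symm
      simp [image_eq_zero_of_notMem_tsupport fun h => hx (hgΩ h)]
  refine Lp.eq_zero_iff_ae_eq_zero.2 ?_
  exact (ae_restrict_iff' hΩ).2 hzero

end Density

/-! ### Complete accretivity. -/

section CompleteAccretivity

variable {N : ℕ} {Ω : Set (E N)} {p : ℝ} {s : E N → E N → ℝ}

theorem monotone_powDeriv (hp : 1 < p) : Monotone (powDeriv p) := by
  intro a b hab
  by_contra! h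
  have h1 := powDeriv_monotone hp a b
  have h2 : a ≠ b := fun h' => by simp [h'] at h
  have h3 := lt_of_le_of_ne hab h2
  nlinarith

theorem integral_comp_mul_nonneg (hN : 1 ≤ N) (hΩ : MeasurableSet Ω)
    (hΩb : Bornology.IsBounded Ω) (hp : 1 < p) (hs : IsVariableOrder s) {q : ℝ → ℝ} {C : ℝ≥0}
    (hq : LipschitzWith C q) (hqm : Monotone q) (hq0 : q 0 = 0) {u v u' v' : L2 Ω}
    (h : (u, v) ∈ operatorA p s Ω) (h' : (u', v') ∈ operatorA p s Ω) :
    Integrable (fun x => q ((u - u') x) * (v - v') x) (volume.restrict Ω) ∧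
      0 ≤ ∫ x in Ω, q ((u - u') x) * (v - v') x := by
  have hp0 : 0 < p := by linarith
  obtain ⟨hu, he⟩ := mem_operatorA_iff.1 h
  obtain ⟨hu', he'⟩ := mem_operatorA_iff.1 h'
  set φ : L2 Ω := hq.compLp hq0 (u - u') with hφ
  have hφae : φ =ᵐ[volume.restrict Ω] q ∘ (u - u' : L2 Ω) := hq.coeFn_compLp hq0 _
  have hφm : φ ∈ L2X0 p s Ω := comp_mem_L2X0 hN hΩ hΩb hp0 hs hq hq0
    ((L2X0Submodule hN hΩ hΩb hp0 hs).sub_mem hu hu') hφae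
  have hae : (fun x => φ x * (v - v') x) =ᵐ[volume.restrict Ω]
      fun x => q ((u - u') x) * (v - v') x := hφae.mul (ae_eq_refl _)
  refine ⟨((Lp.memLp φ).integrable_mul (Lp.memLp (v - v'))).congr hae, ?_⟩
  rw [← integral_congr_ae hae, ← inner_L2_eq, real_inner_comm, inner_sub_left, he φ hφm,
    he' φ hφm, ← mul_sub]
  have hU := (mem_L2X0_iff hN hΩ hΩb hp0 hs).1 hu
  have hU' := (mem_L2X0_iff hN hΩ hΩb hp0 hs).1 hu'
  have hV := (mem_L2X0_iff hN hΩ hΩb hp0 hs).1 hφm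
  rw [← integral_sub (integrable_powDeriv_mul hp hU hV) (integrable_powDeriv_mul hp hU' hV)]
  refine mul_nonneg (by norm_num) (integral_nonneg_of_ae ?_)
  have hext : zeroExt Ω φ =ᵐ[volume] q ∘ (zeroExt Ω u - zeroExt Ω u') :=
    (zeroExt_comp hΩ hq0 hφae).trans ((zeroExt_sub hΩ u u').fun_comp q)
  filter_upwards [tilde_ae_eq (p := p) (s := s) (Ω := Ω) hext] with z hz
  rw [hz, Pi.zero_apply, ← sub_mul]
  simp only [tilde, Function.comp_apply, Pi.sub_apply]
  -- The difference of the `tilde`s equals the difference of `u - u'` at the two points, so the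
  -- order of these two values fixes the sign of both factors.
  rcases le_total (zeroExt Ω u z.1 - zeroExt Ω u' z.1) (zeroExt Ω u z.2 - zeroExt Ω u' z.2)
    with hle | hle
  · exact mul_nonneg_of_nonpos_of_nonpos
      (sub_nonpos.2 (monotone_powDeriv hp (by linarith))) (sub_nonpos.2 (hqm hle))
  · exact mul_nonneg (sub_nonneg.2 (monotone_powDeriv hp (by linarith))) (sub_nonneg.2 (hqm hle))

/-- Quadratic growth makes both sides finite, so the subgradient inequality at `U x` in the
direction `r * Z x` can be integrated; the sign of the cross term allows it to be dropped. -/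
theorem lintegral_le_of_subgradient {α : Type*} {m : MeasurableSpace α} {μ : Measure α}
    {k q : ℝ → ℝ} (hkm : Measurable k) (hk0 : ∀ x, 0 ≤ k x) {c : ℝ} (hkc : ∀ x, k x ≤ c * x ^ 2)
    (hkq : ∀ x y, k x + q x * (y - x) ≤ k y) {U Y Z : α → ℝ} (hU : MemLp U 2 μ) (hY : MemLp Y 2 μ)
    {r : ℝ} (hr : 0 ≤ r) (hYU : ∀ᵐ x ∂μ, Y x = U x + r * Z x)
    (hint : Integrable (fun x => q (U x) * Z x) μ) (hnonneg : 0 ≤ ∫ x, q (U x) * Z x ∂μ) :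
    ∫⁻ x, ENNReal.ofReal (k (U x)) ∂μ ≤ ∫⁻ x, ENNReal.ofReal (k (Y x)) ∂μ := by
  have hki : ∀ {W : α → ℝ}, MemLp W 2 μ → Integrable (fun x => k (W x)) μ := fun {W} hW => by
    refine (hW.integrable_sq.const_mul c).mono'
      (hkm.comp_aemeasurable hW.1.aemeasurable).aestronglyMeasurable (ae_of_all _ fun x => ?_)
    rw [Real.norm_of_nonneg (hk0 _)]
    exact hkc _
  rw [← ofReal_integral_eq_lintegral_ofReal (hki hU) (ae_of_all _ fun x => hk0 _),
    ← ofReal_integral_eq_lintegral_ofReal (hki hY) (ae_of_all _ fun x => hk0 _)]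
  refine ENNReal.ofReal_le_ofReal ?_
  have h1 := integral_mono_ae ((hki hU).add (hint.const_mul r)) (hki hY)
    (hYU.mono fun x hx => by
      have := hkq (U x) (Y x)
      refine le_trans (le_of_eq ?_) this
      simp only [Pi.add_apply]
      rw [hx]; ring)
  simp only [Pi.add_apply] at h1
  rw [integral_add (hki hU) (hint.const_mul r), integral_const_mul] at h1
  nlinarith [mul_nonneg hr hnonneg]

/-- The inequality holds for each Moreau envelope of `j`; Fatou on the left and `k n ≤ j` on the
right transfer it to `j`, with no integrability required of `j`. -/
theorem isCompletelyAccretive_operatorA (hN : 1 ≤ N) (hΩ : MeasurableSet Ω)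
    (hΩb : Bornology.IsBounded Ω) (hp : 1 < p) (hs : IsVariableOrder s) :
    IsCompletelyAccretive (operatorA p s Ω) := by
  rintro ⟨u, v⟩ h ⟨u', v'⟩ h' r hr j hj
  simp only
  have hl : ∀ n : ℕ, (0 : ℝ) < 1 / (n + 1 : ℝ) := fun n => by positivity
  choose P q k hx hP hqL hqm hq0 hkm hk0 hkc hkq hkj hkP using fun n => exists_moreau hj (hl n)
  have hYU : ∀ᵐ x ∂(volume.restrict Ω),
      (u - u' + r • (v - v')) x = (u - u') x + r * (v - v') x := by
    filter_upwards [Lp.coeFn_add (u - u') (r • (v - v')), Lp.coeFn_smul r (v - v')] with x h1 h2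
    rw [h1, Pi.add_apply, h2]; rfl
  have hm := (Lp.aestronglyMeasurable (u - u')).aemeasurable
  calc ∫⁻ x in Ω, j ((u - u') x)
      ≤ ∫⁻ x in Ω, liminf (fun n => ENNReal.ofReal (k n ((u - u') x))) atTop := by
        refine lintegral_mono fun x => ?_
        simp only [hkP]
        exact le_liminf_of_moreau hj.2.1 hl tendsto_one_div_add_atTop_nhds_zero_nat
          fun n => hx n _
    _ ≤ liminf (fun n => ∫⁻ x in Ω, ENNReal.ofReal (k n ((u - u') x))) atTop :=
        lintegral_liminf_le' fun n => ((hkm n).comp_aemeasurable hm).ennreal_ofReal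
    _ ≤ ∫⁻ x in Ω, j ((u - u' + r • (v - v')) x) := by
        refine liminf_le_of_frequently_le' (Frequently.of_forall fun n => ?_)
        obtain ⟨C, hC⟩ := hqL n
        obtain ⟨hint, hnonneg⟩ :=
          integral_comp_mul_nonneg hN hΩ hΩb hp hs hC (hqm n) (hq0 n) h h'
        exact (lintegral_le_of_subgradient (hkm n) (hk0 n) (hkc n) (hkq n) (Lp.memLp _)
          (Lp.memLp _) hr.le hYU hint hnonneg).trans (lintegral_mono fun x => hkj n _)

end CompleteAccretivity

end VarFrac

end

theorem mainTheorem5 (N : ℕ) (hN : 1 ≤ N) (Ω : Set (VarFrac.E N)) (hΩo : IsOpen Ω)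
    (hΩc : IsConnected Ω) (hΩb : Bornology.IsBounded Ω) (p : ℝ) (hp : 1 < p)
    (s : VarFrac.E N → VarFrac.E N → ℝ) (hs : VarFrac.IsVariableOrder s) :
    VarFrac.IsMCompletelyAccretive (VarFrac.operatorA p s Ω) ∧
    Dense (VarFrac.opDomain (VarFrac.operatorA p s Ω)) ∧
    ConvexOn ℝ≥0 Set.univ (VarFrac.functionalA p s Ω) ∧
    VarFrac.operatorA p s Ω = VarFrac.subdifferential (VarFrac.functionalA p s Ω) := by
  have hΩ := hΩo.measurableSet
  have hp0 : 0 < p := by linarith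
  have hconv := VarFrac.convexOn_functionalA hN hΩ hΩb hp hs
  have hlsc := VarFrac.lowerSemicontinuous_functionalA hN hΩ hΩb hp hs
  have heq := VarFrac.operatorA_eq_subdifferential hN hΩ hΩb hp hs
  have hzero : VarFrac.functionalA p s Ω 0 ≠ ∞ :=
    VarFrac.functionalA_ne_top_iff.2 (VarFrac.L2X0Submodule hN hΩ hΩb hp0 hs).zero_mem
  refine ⟨⟨VarFrac.isCompletelyAccretive_operatorA hN hΩ hΩb hp hs, fun r hr h => ?_⟩, ?_,
    hconv, heq⟩
  · obtain ⟨u, hu⟩ := VarFrac.exists_resolvent hconv hlsc hzero hr h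
    refine ⟨(u, r⁻¹ • (h - u)), heq ▸ hu, ?_⟩
    simp only [smul_inv_smul₀ hr.ne', add_sub_cancel]
  · rw [heq]
    refine VarFrac.dense_opDomain_subdifferential hconv hlsc ?_
    have : {x | VarFrac.functionalA p s Ω x ≠ ∞} = VarFrac.L2X0 p s Ω :=
      Set.ext fun _ => VarFrac.functionalA_ne_top_iff
    rw [this]
    exact VarFrac.dense_L2X0 hN hΩo hΩb hp0 hs
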